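/- Let $(B_i,A_i)_{i\ge 1}$ be i.i.d. random vectors with values almost surely in $[0,\infty)^2$, where $B_i$ and $A_i$ may be arbitrarily dependent. Put $$b_n=\sum_{i=1}^n B_i,\qquad S_n=\sum_{i=1}^n (B_i-A_i),\qquad S_0=0,\qquad h(s_1,s_2)=\mathbb E\,e^{-s_1B_1-s_2A_1}\quad(\operatorname{Re}s_1,\operatorname{Re}s_2\ge 0),$$ let $N=\inf\{n\ge 1: S_n<0\}\in\{1,2,\dots\}\cup\{\infty\}$, and let $P=b_N$ (the busy period) and $I=-S_N$ (the idle period) on $\{N<\infty\}$; the variables $z^Ne^{-sP}$ and $z^Ne^{-sI}$ are taken to be $0$ on $\{N=\infty\}$. Assume that $\mathbb P(S_n=0)=0$ for all $n\ge 1$. Write $$\mathrm{p.v.}\!\!\int_{-i\infty}^{i\infty}F(\xi)\,d\xi=\lim_{T\to\infty}\int_{-iT}^{iT}F(\xi)\,d\xi,$$ and let $\log$ be the principal branch of the logarithm. Let $s,z\in\mathbb C$ with $\operatorname{Re}s>0$ and $|z|<1$. Then $z^Ne^{-sI}$ is integrable, the following limit integral exists, and $$\mathbb E\big[z^Ne^{-sI}\big]=1-\exp\left\{\frac1{2\pi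 i}\mathrm{p.v.}\!\!\int_{-i\infty}^{i\infty}\frac{d\xi}{s+\xi}\,\log\big(1-z\,h(\xi,-\xi)\big)\right\}.$$ If moreover $\mathbb P(B_1=0)=0$, then $z^Ne^{-sP}$ is integrable, the following limit integral exists, and $$\mathbb E\big[z^Ne^{-sP}\big]=1-\exp\left\{\frac1{2\pi i}\mathrm{p.v.}\!\!\int_{-i\infty}^{i\infty}\frac{d\xi}{s-\xi}\,\Big[\log\big(1-z\,h(\xi,0)\big)-\log\big(1-z\,h(\xi,s-\xi)\big)\Big]\right\}.$$ -/

import Mathlib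

open MeasureTheory ProbabilityTheory Filter Topology

noncomputable section

namespace CorrelatedWalk

/-- The joint Laplace-Stieltjes transform `h(s₁, s₂) = E[exp(-s₁ B - s₂ A)]` of a random vector
`(B, A)` with law `μ` on `ℝ²`. -/
def jointLST (μ : Measure (ℝ × ℝ)) (s₁ s₂ : ℂ) : ℂ :=
  ∫ p, Complex.exp (-s₁ * (p.1 : ℂ) - s₂ * (p.2 : ℂ)) ∂μ

/-- The partial sums `x_1 + ⋯ + x_n` of a sequence of random variables, which is indexed from `0`:
`x_i` is `X (i - 1)`. -/
def partialSum {Ω : Type*} (X : ℕ → Ω → ℝ) (n : ℕ) (ω : Ω) : ℝ :=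
  ∑ i ∈ Finset.range n, X i ω

/-- The random walk `S_n = ∑_{i ≤ n} (B_i - A_i)`, started at `S_0 = 0`. -/
def walk {Ω : Type*} (B A : ℕ → Ω → ℝ) (n : ℕ) (ω : Ω) : ℝ :=
  partialSum (fun i ω => B i ω - A i ω) n ω

/-- `N`, the first time at which the walk is strictly negative (`⊤` if it never is). -/
def ladderTime {Ω : Type*} (B A : ℕ → Ω → ℝ) : Ω → WithTop ℕ :=
  hittingAfter (walk B A) (Set.Iio 0) 0

/-- The busy period `P = b_N` (meaningful on `{N < ∞}`). -/
def busyPeriod {Ω : Type*} (B A : ℕ → Ω → ℝ) : Ω → ℝ :=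
  stoppedValue (partialSum B) (ladderTime B A)

/-- The idle period `I = -S_N` (meaningful on `{N < ∞}`). -/
def idlePeriod {Ω : Type*} (B A : ℕ → Ω → ℝ) : Ω → ℝ :=
  fun ω => -stoppedValue (walk B A) (ladderTime B A) ω

/-- The random variable `z ^ N * exp(-s Y)`, equal to `0` on `{N = ∞}`, as `z ^ ∞ = 0` for
`‖z‖ < 1`. -/
def discounted {Ω : Type*} (N : Ω → WithTop ℕ) (Y : Ω → ℝ) (z s : ℂ) : Ω → ℂ :=
  {ω | N ω ≠ ⊤}.indicator fun ω => z ^ (N ω).untopA * Complex.exp (-s * (Y ω : ℂ))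

/-- The dashed integral of `F` along the imaginary axis exists and has the value `L`: with the
parametrization `ξ = i t`, the integrals of `F` over the segments `[-iT, iT]` exist and converge
to `L` as `T → ∞`. -/
def HasPVIntegral (F : ℂ → ℂ) (L : ℂ) : Prop :=
  (∀ T : ℝ, IntervalIntegrable (fun t : ℝ => F (t * Complex.I) * Complex.I) volume (-T) T) ∧
    Tendsto (fun T : ℝ => ∫ t in (-T)..T, F (t * Complex.I) * Complex.I) atTop (𝓝 L)

end CorrelatedWalk

end

namespace CorrelatedWalk

/-! Two ingredients meet in one power series. Let a be the law of (B_1, A_1), U_n the law of the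
plane walk (b_n, a_n) on {S_0, ..., S_n ≥ 0}, and V_n its law on {N = n}. Finite measures form a
commutative semiring under convolution, and restriction to {b ≥ a} and to {b < a} gives
complementary projections p, q whose ranges are closed under products. One step of the walk reads
U_{n+1} + V_{n+1} = U_n a, so the generating functions satisfy (1 - xa) U = 1 - V. Taking logarithms
and projecting gives log(1 - V) = -∑ q(a^n) x^n / n; `spitzer_recurrence` is the differentiated form
of this, coefficient by coefficient, free of subtraction and division. Integrating a multiplicative
function χ of the position yields `one_sub_tsum_integral_exitsAt`: 1 - ∑ z^n E[χ; N = n] = exp(-∑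
z^n/n E[χ; S_n < 0]). The choices χ = e^{-sb} and χ = e^{-s(a-b)} give P and I.

It remains to recognise the exponent as an integral. The principal value of (1/2πi) ∫ e^{-ξx}/(s-ξ)
dξ is e^{-sx} for x > 0 and 0 for x < 0 (`tendsto_cauchyKernel_of_pos`,
`tendsto_cauchyKernel_of_neg`). The truncated integrals are bounded uniformly in x and T
(`cauchyKernel_uniformly_bounded`), so the limit passes through expectations and through log(1 - zh)
= -∑ z^n h^n / n, where h^n is the transform of the n-step walk. For I, reflect ξ and take x = -S_n.
For P, the first logarithm produces e^{-s b_n} on {b_n > 0}, the second e^{-s b_n} on {S_n > 0}, and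
the difference lives on {S_n < 0}. At x = 0 the limit is the midpoint of the jump, which is why S_n
= 0 and b_n = 0 must be null events. -/

/-! ### The Spitzer-Baxter identity in a commutative semiring with two projections. -/

/-- First-passage decomposition for the sequences generated by a projection. -/
theorem first_passage_decomposition {R : Type*} [CommSemiring R] (a : R) (U V : ℕ → R)
    (hU0 : U 0 = 1) (hV0 : V 0 = 0) (hUV : ∀ n, U (n + 1) + V (n + 1) = U n * a) (n : ℕ) :
    U n + ∑ k ∈ Finset.range (n + 1), a ^ k * V (n - k) = a ^ n := by
  induction n with
  | zero => simp [hU0, hV0]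
  | succ n ih =>
    rw [Finset.sum_range_succ']
    have : ∑ k ∈ Finset.range (n + 1), a ^ (k + 1) * V (n + 1 - (k + 1))
        = (∑ k ∈ Finset.range (n + 1), a ^ k * V (n - k)) * a := by
      rw [Finset.sum_mul]
      refine Finset.sum_congr rfl fun k _ => ?_
      rw [Nat.add_sub_add_right]; ring
    rw [this, pow_succ, ← ih, add_mul, ← hUV]
    simp only [pow_zero, one_mul, Nat.sub_zero]
    ring

/-- The Spitzer-Baxter identity in logarithmic-derivative form, in a commutative semiring which is
the direct sum of two subsemirings. -/
theorem spitzer_recurrence {R : Type*} [CommSemiring R] (p q : R →+ R)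
    (hpq : ∀ x, p x + q x = x) (hpp : ∀ x y, p (p x * p y) = p x * p y)
    (hqq : ∀ x y, q (q x * q y) = q x * q y) (h01 : ∀ x, p (q x) = 0) (h10 : ∀ x, q (p x) = 0)
    (p_one : p 1 = 1) (a : R) (U V : ℕ → R) (hU0 : U 0 = 1) (hV0 : V 0 = 0)
    (hU : ∀ n, U (n + 1) = p (U n * a)) (hV : ∀ n, V (n + 1) = q (U n * a)) (n : ℕ) :
    ∑ k ∈ Finset.range (n + 1), q (a ^ (k + 1)) * V (n - k) + (n + 1) • V (n + 1)
      = q (a ^ (n + 1)) := by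
  have hUV : ∀ n, U (n + 1) + V (n + 1) = U n * a := fun n => by rw [hU, hV, hpq]
  have hpU : ∀ n, ∃ y, U n = p y := by
    rintro (_ | n)
    exacts [⟨1, by rw [hU0, p_one]⟩, ⟨_, hU n⟩]
  have hqV : ∀ n, ∃ y, V n = q y := by
    rintro (_ | n)
    exacts [⟨0, by rw [hV0, map_zero]⟩, ⟨_, hV n⟩]
  have pU : ∀ x n, p (p x * U n) = p x * U n ∧ q (p x * U n) = 0 := fun x n => by
    obtain ⟨y, hy⟩ := hpU n
    rw [hy]
    exact ⟨hpp _ _, by rw [← hpp, h10]⟩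
  have qV : ∀ x n, q (q x * V n) = q x * V n ∧ p (q x * V n) = 0 := fun x n => by
    obtain ⟨y, hy⟩ := hqV n
    rw [hy]
    exact ⟨hqq _ _, by rw [← hqq, h01]⟩
  -- Measures cannot be subtracted, so the recurrences for `U` and `V` are proved as one balanced
  -- identity. Each summand is fixed by one projection and killed by the other: applying `p` gives
  -- the recurrence for `U` at n + 1, which feeds the induction, and applying `q` gives the one for
  -- `V`.
  have key : ∀ n, (n • U n = ∑ k ∈ Finset.range n, p (a ^ (k + 1)) * U (n - 1 - k)) →
      (∑ k ∈ Finset.range (n + 1), q (a ^ (k + 1)) * V (n - k)) + (n + 1) • U (n + 1)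
        + (n + 1) • V (n + 1)
      = (∑ k ∈ Finset.range (n + 1), p (a ^ (k + 1)) * U (n - k)) + q (a ^ (n + 1)) := by
    intro n ih
    have e1 : (n + 1) • U (n + 1) + (n + 1) • V (n + 1) = U n * a
        + ∑ k ∈ Finset.range n, p (a ^ (k + 1)) * (U (n - k) + V (n - k)) := by
      rw [← nsmul_add, hUV, add_nsmul, one_nsmul, ← smul_mul_assoc, ih, Finset.sum_mul, add_comm]
      congr 1
      refine Finset.sum_congr rfl fun k hk => ?_
      have hk' := Finset.mem_range.1 hk
      obtain ⟨j, rfl⟩ : ∃ j, n = k + 1 + j := ⟨n - (k + 1), by omega⟩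
      rw [show k + 1 + j - 1 - k = j by omega, show k + 1 + j - k = j + 1 by omega, hUV, mul_assoc]
    have e2 : ∑ k ∈ Finset.range n, p (a ^ (k + 1)) * V (n - k)
        = ∑ k ∈ Finset.range (n + 1), p (a ^ (k + 1)) * V (n - k) := by
      simp [Finset.sum_range_succ, hV0]
    -- Multiplying the decomposition of a^n by a expresses a^(n+1) through powers a^(k+1), each of
    -- which is then split by `p` and `q`.
    have e3 := congrArg (· * a) (first_passage_decomposition a U V hU0 hV0 hUV n)
    simp only [add_mul, Finset.sum_mul, ← pow_succ] at e3
    have e4 : ∑ k ∈ Finset.range (n + 1), a ^ k * V (n - k) * a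
        = ∑ k ∈ Finset.range (n + 1), p (a ^ (k + 1)) * V (n - k)
          + ∑ k ∈ Finset.range (n + 1), q (a ^ (k + 1)) * V (n - k) := by
      rw [← Finset.sum_add_distrib]
      refine Finset.sum_congr rfl fun k _ => ?_
      rw [← add_mul, hpq]; ring
    rw [add_assoc, e1, Finset.sum_range_succ (fun k => p (a ^ (k + 1)) * U (n - k)), Nat.sub_self,
      hU0, mul_one, add_assoc _ (p _), hpq, ← e3, e4]
    simp only [mul_add, Finset.sum_add_distrib]
    rw [e2]
    ring
  have hUrec : ∀ n, n • U n = ∑ k ∈ Finset.range n, p (a ^ (k + 1)) * U (n - 1 - k) := by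
    intro n
    induction n with
    | zero => simp
    | succ n ih =>
      have := congrArg p (key n ih)
      have hUp : p (U (n + 1)) = U (n + 1) := by simpa [p_one] using (pU 1 (n + 1)).1
      have hVp : p (V (n + 1)) = 0 := by rw [hV, h01]
      simpa [(pU _ _).1, (qV _ _).2, h01, hUp, hVp, -nsmul_eq_mul] using this
  have := congrArg q (key n (hUrec n))
  have hUq : q (U (n + 1)) = 0 := by rw [hU, h10]
  have hVq : q (V (n + 1)) = V (n + 1) := by
    have h := hpq (V (n + 1))
    rwa [hV, h01, zero_add, ← hV] at h
  have hqq' : ∀ x, q (q x) = q x := fun x => by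
    have h := hpq (q x)
    rwa [h01, zero_add] at h
  simpa [(pU _ _).2, (qV _ _).1, hqq', hUq, hVq, -nsmul_eq_mul] using this

/-! ### The convolution semiring of finite measures and its restriction projections. -/

section FiniteMeasureSemiring

variable {G : Type*} [AddCommMonoid G] [MeasurableSpace G] [MeasurableAdd₂ G]

/-- Finite measures on a commutative additive monoid form a semiring under convolution. -/
noncomputable instance finiteMeasureCommSemiring : CommSemiring (FiniteMeasure G) where
  mul m m' := ⟨(m : Measure G) ∗ (m' : Measure G), inferInstance⟩
  one := ⟨Measure.dirac 0, inferInstance⟩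
  left_distrib a b c := Subtype.ext (Measure.conv_add _ _ _)
  right_distrib a b c := Subtype.ext (Measure.add_conv _ _ _)
  zero_mul a := Subtype.ext (Measure.zero_conv _)
  mul_zero a := Subtype.ext (Measure.conv_zero _)
  mul_assoc a b c := Subtype.ext (Measure.conv_assoc _ _ _)
  one_mul a := Subtype.ext (Measure.dirac_zero_conv _)
  mul_one a := Subtype.ext (Measure.conv_dirac_zero _)
  mul_comm a b := Subtype.ext (Measure.conv_comm _ _)

theorem toMeasure_mul (m m' : FiniteMeasure G) :
    ((m * m' : FiniteMeasure G) : Measure G) = (m : Measure G) ∗ (m' : Measure G) := rfl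

theorem toMeasure_one : ((1 : FiniteMeasure G) : Measure G) = Measure.dirac 0 := rfl

/-- Restriction of finite measures to a set, as an additive map. -/
noncomputable def restrictHom (S : Set G) : FiniteMeasure G →+ FiniteMeasure G where
  toFun m := m.restrict S
  map_zero' := Subtype.ext (Measure.restrict_zero S)
  map_add' _ _ := Subtype.ext (Measure.restrict_add _ _ S)

theorem toMeasure_restrictHom (S : Set G) (m : FiniteMeasure G) :
    (restrictHom S m : Measure G) = (m : Measure G).restrict S := rfl

theorem restrictHom_add_compl {S : Set G} (hS : MeasurableSet S) (m : FiniteMeasure G) :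
    restrictHom S m + restrictHom Sᶜ m = m :=
  Subtype.ext (Measure.restrict_add_restrict_compl hS)

theorem ae_conv_of_ae {S : Set G} (hS : MeasurableSet S) (hadd : ∀ x ∈ S, ∀ y ∈ S, x + y ∈ S)
    {m m' : Measure G} [SFinite m] [SFinite m'] (h : ∀ᵐ x ∂m, x ∈ S) (h' : ∀ᵐ x ∂m', x ∈ S) :
    ∀ᵐ x ∂(m ∗ m'), x ∈ S := by
  refine (ae_map_iff (p := fun x => x ∈ S) (by fun_prop) hS).2 ?_
  have h1 : ∀ᵐ x ∂(m.prod m'), x.1 ∈ S := Measure.quasiMeasurePreserving_fst.ae h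
  have h2 : ∀ᵐ x ∂(m.prod m'), x.2 ∈ S := Measure.quasiMeasurePreserving_snd.ae h'
  filter_upwards [h1, h2] with x hx hy using hadd _ hx _ hy

theorem restrictHom_mul {S : Set G} (hS : MeasurableSet S)
    (hadd : ∀ x ∈ S, ∀ y ∈ S, x + y ∈ S) (m m' : FiniteMeasure G) :
    restrictHom S (restrictHom S m * restrictHom S m') = restrictHom S m * restrictHom S m' := by
  refine Subtype.ext (Measure.restrict_eq_self_of_ae_mem ?_)
  exact ae_conv_of_ae hS hadd (ae_restrict_mem hS) (ae_restrict_mem hS)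

theorem restrictHom_restrictHom_of_disjoint {S T : Set G} (hS : MeasurableSet S)
    (hST : Disjoint S T) (m : FiniteMeasure G) : restrictHom S (restrictHom T m) = 0 := by
  refine Subtype.ext ((Measure.restrict_restrict hS).trans ?_)
  rw [hST.inter_eq, Measure.restrict_empty]
  rfl

theorem finiteMeasure_spitzer_recurrence {S : Set G} (hS : MeasurableSet S)
    (hadd : ∀ x ∈ S, ∀ y ∈ S, x + y ∈ S) (hadd' : ∀ x ∈ Sᶜ, ∀ y ∈ Sᶜ, x + y ∈ Sᶜ) (h0 : 0 ∈ S)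
    (a : FiniteMeasure G) (U V : ℕ → FiniteMeasure G) (hU0 : U 0 = 1) (hV0 : V 0 = 0)
    (hU : ∀ n, U (n + 1) = restrictHom S (U n * a))
    (hV : ∀ n, V (n + 1) = restrictHom Sᶜ (U n * a)) (n : ℕ) :
    ∑ k ∈ Finset.range (n + 1), restrictHom Sᶜ (a ^ (k + 1)) * V (n - k) + (n + 1) • V (n + 1)
      = restrictHom Sᶜ (a ^ (n + 1)) := by
  refine spitzer_recurrence (restrictHom S) (restrictHom Sᶜ) (restrictHom_add_compl hS)
    (restrictHom_mul hS hadd) (restrictHom_mul hS.compl hadd')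
    (restrictHom_restrictHom_of_disjoint hS disjoint_compl_right)
    (restrictHom_restrictHom_of_disjoint hS.compl disjoint_compl_left) ?_ a U V hU0 hV0 hU hV n
  refine Subtype.ext (Measure.restrict_eq_self_of_ae_mem ?_)
  exact (ae_dirac_iff hS).2 h0

theorem integral_conv_of_map_add {m m' : Measure G} [SFinite m] [SFinite m'] {χ : G → ℂ}
    (hχ : Measurable χ) (hmul : ∀ x y, χ (x + y) = χ x * χ y) :
    ∫ x, χ x ∂(m ∗ m') = (∫ x, χ x ∂m) * ∫ x, χ x ∂m' := by
  rw [Measure.conv, integral_map (by fun_prop) hχ.aestronglyMeasurable, ← integral_prod_mul]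
  simp_rw [hmul]

/-- The recurrence for the transforms. -/
theorem integral_spitzer_recurrence {S : Set G} (hS : MeasurableSet S)
    (hadd : ∀ x ∈ S, ∀ y ∈ S, x + y ∈ S) (hadd' : ∀ x ∈ Sᶜ, ∀ y ∈ Sᶜ, x + y ∈ Sᶜ) (h0 : 0 ∈ S)
    (a : FiniteMeasure G) (U V : ℕ → FiniteMeasure G) (hU0 : U 0 = 1) (hV0 : V 0 = 0)
    (hU : ∀ n, U (n + 1) = restrictHom S (U n * a))
    (hV : ∀ n, V (n + 1) = restrictHom Sᶜ (U n * a))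
    {χ : G → ℂ} (hχ : Measurable χ) (hmul : ∀ x y, χ (x + y) = χ x * χ y)
    (hintA : ∀ n, Integrable χ (restrictHom Sᶜ (a ^ n) : Measure G))
    (hintV : ∀ n, Integrable χ (V n : Measure G)) (n : ℕ) :
    ∑ k ∈ Finset.range (n + 1), (∫ x, χ x ∂(restrictHom Sᶜ (a ^ (k + 1)) : Measure G))
        * ∫ x, χ x ∂(V (n - k) : Measure G)
      + (n + 1) * ∫ x, χ x ∂(V (n + 1) : Measure G)
      = ∫ x, χ x ∂(restrictHom Sᶜ (a ^ (n + 1)) : Measure G) := by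
  rw [← finiteMeasure_spitzer_recurrence hS hadd hadd' h0 a U V hU0 hV0 hU hV n]
  have hmulint : ∀ k, Integrable χ
      ((restrictHom Sᶜ (a ^ (k + 1)) * V (n - k) : FiniteMeasure G) : Measure G) := by
    intro k
    rw [toMeasure_mul, Measure.conv, integrable_map_measure hχ.aestronglyMeasurable (by fun_prop)]
    simp only [Function.comp_def, hmul]
    exact (hintA _).mul_prod (hintV _)
  rw [FiniteMeasure.toMeasure_add, FiniteMeasure.toMeasure_sum, FiniteMeasure.toMeasure_smul,
    integral_add_measure, integral_finsetSum_measure]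
  · congr 1
    · refine Finset.sum_congr rfl fun k _ => ?_
      rw [toMeasure_mul, integral_conv_of_map_add hχ hmul]
    · rw [← Nat.cast_smul_eq_nsmul ENNReal, integral_smul_measure]
      simp [ENNReal.toReal_add]
  · exact fun k _ => hmulint k
  · exact integrable_finsetSum_measure.2 fun k _ => hmulint k
  · rw [← Nat.cast_smul_eq_nsmul ENNReal]
    exact (hintV _).smul_measure (by finiteness)

end FiniteMeasureSemiring

/-! ### Power series in the unit disc: from the recurrence to an exponential. -/

/-- Linear growth is allowed so that the lemma serves both `a n` and `n * v n`; in the latter case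
the factor n cancels the denominator. The term n = 0 vanishes because division by zero gives zero.
-/
theorem hasDerivAt_tsum_mul_pow {c : ℕ → ℂ} {C : ℝ} (hc : ∀ n, ‖c n‖ ≤ C * (n + 1)) {z : ℂ} (hz : ‖z‖ < 1) :
    HasDerivAt (fun w : ℂ => ∑' n, c n * w ^ n / n) (∑' n, c (n + 1) * z ^ n) z := by
  obtain ⟨r, hzr, hr1⟩ := exists_between hz
  have hr0 : 0 ≤ r := (norm_nonneg z).trans hzr.le
  have hC : 0 ≤ C := by simpa using (norm_nonneg _).trans (hc 0)
  have hu : Summable fun n : ℕ => C * (n + 1) * r ^ (n - 1) := by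
    refine (summable_nat_add_iff 1).1 ?_
    have h1 := summable_pow_mul_geometric_of_norm_lt_one 1 (r := r) (by rwa [Real.norm_of_nonneg hr0])
    refine ((h1.add ((summable_geometric_of_lt_one hr0 hr1).mul_left 2)).mul_left C).congr
      fun n => ?_
    rw [Nat.add_sub_cancel]; push_cast; ring
  have key := hasDerivAt_tsum_of_isPreconnected (g := fun (n : ℕ) (w : ℂ) => c n * w ^ n / n)
    (g' := fun (n : ℕ) (w : ℂ) => if n = 0 then 0 else c n * w ^ (n - 1)) hu
    (Metric.isOpen_ball (x := (0 : ℂ)) (ε := r)) (convex_ball _ _).isPreconnected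
    (y₀ := 0) (y := z) ?_ ?_ (Metric.mem_ball_self ((norm_nonneg z).trans_lt hzr)) ?_
    (by simpa using hzr)
  · refine key.congr_deriv ?_
    rw [Summable.tsum_eq_zero_add]
    · simp
    · refine Summable.of_norm_bounded hu fun n => ?_
      split_ifs
      · simp; positivity
      · rw [norm_mul, norm_pow]; gcongr; exact hc n
  · intro n w _
    rcases eq_or_ne n 0 with rfl | hn
    · simpa using hasDerivAt_const w (0 : ℂ)
    · have hn' : (n : ℂ) ≠ 0 := Nat.cast_ne_zero.2 hn
      refine (((hasDerivAt_pow n w).const_mul (c n)).div_const (n : ℂ)).congr_deriv ?_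
      rw [if_neg hn]; field_simp
  · intro n w hw
    have hw' : ‖w‖ ≤ r := by simpa using (Metric.mem_ball.1 hw).le
    split_ifs
    · simp; positivity
    · rw [norm_mul, norm_pow]; gcongr; exact hc n
  · refine summable_of_ne_finset_zero (s := {0}) fun n hn => ?_
    have : n ≠ 0 := by simpa using hn
    simp [this]

/-- A power series whose logarithmic derivative satisfies the convolution recurrence is an
exponential. -/
theorem one_sub_tsum_eq_exp {v a : ℕ → ℂ} {C : ℝ} (hv : ∀ n, ‖v n‖ ≤ C) (ha : ∀ n, ‖a n‖ ≤ C)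
    (hv0 : v 0 = 0)
    (hrec : ∀ n : ℕ, ∑ k ∈ Finset.range (n + 1), a (k + 1) * v (n - k) + (n + 1) * v (n + 1)
      = a (n + 1)) {z : ℂ} (hz : ‖z‖ < 1) :
    1 - ∑' n, v n * z ^ n = Complex.exp (-∑' n, a n * z ^ n / n) := by
  have hsum : ∀ {c : ℕ → ℂ}, (∀ n, ‖c n‖ ≤ C) → ∀ {w : ℂ}, ‖w‖ < 1 →
      Summable fun n => ‖c n * w ^ n‖ := by
    intro c hc w hw
    refine Summable.of_nonneg_of_le (fun _ => norm_nonneg _) (fun n => ?_)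
      ((summable_geometric_of_lt_one (norm_nonneg w) hw).mul_left C)
    rw [norm_mul, norm_pow]; gcongr; exact hc n
  have hC : 0 ≤ C := (norm_nonneg _).trans (hv 0)
  have hvn : ∀ n : ℕ, ‖n * v n‖ ≤ C * (n + 1) := fun n => by
    rw [norm_mul, Complex.norm_natCast]
    nlinarith [hv n, norm_nonneg (v n), mul_le_mul_of_nonneg_left (hv n) n.cast_nonneg]
  have han : ∀ n : ℕ, ‖a n‖ ≤ C * (n + 1) := fun n => by
    nlinarith [ha n, mul_nonneg hC n.cast_nonneg]
  set f : ℂ → ℂ := fun w => ∑' n, v n * w ^ n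
  set g : ℂ → ℂ := fun w => ∑' n, a n * w ^ n / n
  have hf : ∀ w : ℂ, ‖w‖ < 1 → HasDerivAt f (∑' n : ℕ, ((n + 1 : ℕ) * v (n + 1)) * w ^ n) w := by
    intro w hw
    refine (hasDerivAt_tsum_mul_pow (c := fun n => n * v n) hvn hw).congr_of_eventuallyEq ?_
    refine Eventually.of_forall fun x => tsum_congr fun n => ?_
    rcases eq_or_ne n 0 with rfl | hn
    · simp [hv0]
    · have hn' : (n : ℂ) ≠ 0 := Nat.cast_ne_zero.2 hn
      field_simp
  have hg : ∀ w : ℂ, ‖w‖ < 1 → HasDerivAt g (∑' n, a (n + 1) * w ^ n) w := fun w hw =>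
    hasDerivAt_tsum_mul_pow han hw
  -- By the Cauchy product, `hrec` says f' = (1 - f) g'. Hence (1 - f) e^g has zero derivative and
  -- keeps its value 1 at the origin.
  have hODE : ∀ w : ℂ, ‖w‖ < 1 → ∑' n : ℕ, ((n + 1 : ℕ) * v (n + 1)) * w ^ n
      = (1 - f w) * ∑' n, a (n + 1) * w ^ n := by
    intro w hw
    have s1 := hsum (c := fun n => a (n + 1)) (fun n => ha _) hw
    have s2 := hsum hv hw
    have s3 := summable_norm_sum_mul_range_of_summable_norm s1 s2
    rw [sub_mul, one_mul, mul_comm (f w), tsum_mul_tsum_eq_tsum_sum_range_of_summable_norm s1 s2,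
      ← s1.of_norm.tsum_sub s3.of_norm]
    refine tsum_congr fun n => ?_
    have : ∑ k ∈ Finset.range (n + 1), a (k + 1) * w ^ k * (v (n - k) * w ^ (n - k))
        = (∑ k ∈ Finset.range (n + 1), a (k + 1) * v (n - k)) * w ^ n := by
      rw [Finset.sum_mul]
      refine Finset.sum_congr rfl fun k hk => ?_
      have hk' : k ≤ n := Nat.lt_succ_iff.1 (Finset.mem_range.1 hk)
      rw [← Nat.add_sub_of_le hk', Nat.add_sub_cancel_left, pow_add]; ring
    rw [this, ← hrec n]; push_cast; ring
  have hF : ∀ w : ℂ, ‖w‖ < 1 → HasDerivAt (fun w => (1 - f w) * Complex.exp (g w)) 0 w := by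
    intro w hw
    refine (((hf w hw).const_sub 1).mul (hg w hw).cexp).congr_deriv ?_
    rw [hODE w hw]; ring
  have hconst : (1 - f z) * Complex.exp (g z) = (1 - f 0) * Complex.exp (g 0) := by
    refine (Metric.isOpen_ball (x := (0 : ℂ)) (ε := 1)).is_const_of_deriv_eq_zero
      (f := fun w => (1 - f w) * Complex.exp (g w)) (convex_ball _ _).isPreconnected ?_ ?_
      (by simpa using hz) (by simp)
    · intro w hw
      exact (hF w (by simpa using hw)).differentiableAt.differentiableWithinAt
    · intro w hw
      exact (hF w (by simpa using hw)).deriv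
  have hf0 : f 0 = 0 := by
    rw [show f 0 = v 0 * 0 ^ 0 from tsum_eq_single 0 fun n hn => by simp [hn]]; simp [hv0]
  have hg0 : g 0 = 0 := by
    rw [show g 0 = a 0 * 0 ^ 0 / (0 : ℕ) from tsum_eq_single 0 fun n hn => by simp [hn]]; simp
  rw [hf0, hg0, sub_zero, one_mul, Complex.exp_zero] at hconst
  rw [Complex.exp_neg]
  exact eq_inv_of_mul_eq_one_left hconst

/-! ### The Cauchy kernel: a uniform bound and its limits, obtained without contour integration. -/

/-- The truncated inverse Laplace integral of `1 / (s - ξ)` along the imaginary axis. -/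
noncomputable def cauchyKernel (s : ℂ) (T x : ℝ) : ℂ :=
  ∫ t in (-T)..T, 1 / (s - t * Complex.I) * Complex.exp (-(t * Complex.I) * x)

theorem sub_mul_I_ne_zero {s : ℂ} (hs : 0 < s.re) (t : ℝ) : s - t * Complex.I ≠ 0 := by
  intro h
  have := congrArg Complex.re h
  simp at this
  exact hs.ne' this

theorem continuous_one_div_sub_mul_I {s : ℂ} (hs : 0 < s.re) :
    Continuous fun t : ℝ => 1 / (s - t * Complex.I) :=
  continuous_const.div (by fun_prop) (sub_mul_I_ne_zero hs)

theorem norm_exp_neg_mul_I_mul (t x : ℝ) : ‖Complex.exp (-(t * Complex.I) * x)‖ = 1 := by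
  rw [show -(t * Complex.I) * x = ((-(t * x) : ℝ) : ℂ) * Complex.I by push_cast; ring,
    Complex.norm_exp_ofReal_mul_I]

/-- Combine the bounds Re s and |t| - ‖s‖ for the norm with weights 1 + ‖s‖ and Re s; the weighted
sum is exactly Re s (1 + |t|). -/
theorem exists_norm_sub_mul_I_lower {s : ℂ} (hs : 0 < s.re) :
    ∃ c : ℝ, 0 < c ∧ ∀ t : ℝ, c * (1 + |t|) ≤ ‖s - t * Complex.I‖ := by
  have hd : 0 < 1 + s.re + ‖s‖ := by positivity
  refine ⟨s.re / (1 + s.re + ‖s‖), by positivity, fun t => ?_⟩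
  have h1 : s.re ≤ ‖s - t * Complex.I‖ := by
    simpa using (Complex.re_le_norm (s - t * Complex.I))
  have h2 : |t| - ‖s‖ ≤ ‖s - t * Complex.I‖ := by
    have := norm_sub_norm_le (t * Complex.I : ℂ) s
    rw [norm_sub_rev] at this
    simpa using this
  rw [div_mul_eq_mul_div, div_le_iff₀ hd]
  nlinarith [mul_le_mul_of_nonneg_left h1 (by positivity : 0 ≤ 1 + ‖s‖),
    mul_le_mul_of_nonneg_left h2 hs.le]

theorem norm_one_div_sub_mul_I_le {s : ℂ} {c : ℝ} (hc : 0 < c)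
    (h : ∀ t : ℝ, c * (1 + |t|) ≤ ‖s - t * Complex.I‖) (t : ℝ) :
    ‖1 / (s - t * Complex.I)‖ ≤ 1 / (c * (1 + |t|)) := by
  rw [norm_div, norm_one]
  exact one_div_le_one_div_of_le (by positivity) (h t)

/-- The even part of the kernel `1 / (s - it)`, up to a factor. -/
noncomputable def lorentzian (s : ℂ) (t : ℝ) : ℂ :=
  1 / (s - t * Complex.I) + 1 / (s + t * Complex.I)

theorem add_mul_I_eq (s : ℂ) (t : ℝ) : s + t * Complex.I = s - (-t : ℝ) * Complex.I := by
  push_cast; ring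

theorem continuous_lorentzian {s : ℂ} (hs : 0 < s.re) : Continuous (lorentzian s) := by
  refine (continuous_one_div_sub_mul_I hs).add (continuous_const.div (by fun_prop) fun t => ?_)
  rw [add_mul_I_eq]; exact sub_mul_I_ne_zero hs _

/-- The two fractions add up to 2s / (s² + t²), which decays like t⁻² although each fraction decays
only like t⁻¹. -/
theorem integrable_lorentzian {s : ℂ} (hs : 0 < s.re) : Integrable (lorentzian s) := by
  obtain ⟨c, hc, h⟩ := exists_norm_sub_mul_I_lower hs
  refine (integrable_inv_one_add_sq.const_mul (2 * ‖s‖ / c ^ 2)).mono'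
    (continuous_lorentzian hs).aestronglyMeasurable (Eventually.of_forall fun t => ?_)
  have e : lorentzian s t
      = 2 * s * (1 / (s - t * Complex.I)) * (1 / (s - (-t : ℝ) * Complex.I)) := by
    have n1 := sub_mul_I_ne_zero hs t
    have n2 := sub_mul_I_ne_zero hs (-t)
    have hsum : (s - t * Complex.I) + (s - (-t : ℝ) * Complex.I) = 2 * s := by push_cast; ring
    rw [lorentzian, add_mul_I_eq, ← hsum]
    generalize s - t * Complex.I = d1 at *
    generalize s - (-t : ℝ) * Complex.I = d2 at *
    field_simp
    ring
  have b1 := norm_one_div_sub_mul_I_le hc h t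
  have b2 := norm_one_div_sub_mul_I_le hc h (-t)
  rw [abs_neg] at b2
  rw [e, norm_mul, norm_mul, norm_mul, Complex.norm_ofNat]
  calc 2 * ‖s‖ * ‖1 / (s - t * Complex.I)‖ * ‖1 / (s - (-t : ℝ) * Complex.I)‖
      ≤ 2 * ‖s‖ * (1 / (c * (1 + |t|))) * (1 / (c * (1 + |t|))) := by gcongr
    _ = 2 * ‖s‖ / c ^ 2 * ((1 + |t|) ^ 2)⁻¹ := by field_simp
    _ ≤ 2 * ‖s‖ / c ^ 2 * (1 + t ^ 2)⁻¹ := by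
      gcongr
      nlinarith [abs_nonneg t, sq_abs t]

theorem intervalIntegrable_cauchyKernel {s : ℂ} (hs : 0 < s.re) (x a b : ℝ) :
    IntervalIntegrable (fun t : ℝ => 1 / (s - t * Complex.I) * Complex.exp (-(t * Complex.I) * x))
      volume a b :=
  ((continuous_one_div_sub_mul_I hs).mul (by fun_prop)).intervalIntegrable _ _

theorem cauchyKernel_add_neg {s : ℂ} (hs : 0 < s.re) (T x : ℝ) :
    cauchyKernel s T x + cauchyKernel s T (-x)
      = ∫ t in (-T)..T, lorentzian s t * Complex.exp (-(t * Complex.I) * x) := by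
  have e : cauchyKernel s T (-x)
      = ∫ t in (-T)..T, 1 / (s + t * Complex.I) * Complex.exp (-(t * Complex.I) * x) := by
    rw [cauchyKernel]
    have := intervalIntegral.integral_comp_neg (a := -T) (b := T) (fun t : ℝ =>
      1 / (s - t * Complex.I) * Complex.exp (-(t * Complex.I) * ((-x : ℝ) : ℂ)))
    rw [neg_neg] at this
    rw [← this]
    refine intervalIntegral.integral_congr fun t _ => ?_
    push_cast
    ring_nf
  have hi : Continuous fun t : ℝ =>
      1 / (s + t * Complex.I) * Complex.exp (-(t * Complex.I) * x) := by
    refine (continuous_const.div (by fun_prop) fun t => ?_).mul (by fun_prop)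
    rw [add_mul_I_eq]; exact sub_mul_I_ne_zero hs _
  rw [e, cauchyKernel, ← intervalIntegral.integral_add (intervalIntegrable_cauchyKernel hs x _ _)
    (hi.intervalIntegrable _ _)]
  refine intervalIntegral.integral_congr fun t _ => ?_
  simp only [lorentzian]; ring

theorem integrable_lorentzian_mul_exp {s : ℂ} (hs : 0 < s.re) (x : ℝ) :
    Integrable fun t : ℝ => lorentzian s t * Complex.exp (-(t * Complex.I) * x) := by
  refine (integrable_lorentzian hs).norm.mono'
    ((continuous_lorentzian hs).mul (by fun_prop)).aestronglyMeasurable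
    (Eventually.of_forall fun t => ?_)
  rw [norm_mul, norm_exp_neg_mul_I_mul, mul_one]

theorem norm_cauchyKernel_add_neg_le {s : ℂ} (hs : 0 < s.re) {T : ℝ} (hT : 0 ≤ T) (x : ℝ) :
    ‖cauchyKernel s T x + cauchyKernel s T (-x)‖ ≤ ∫ t, ‖lorentzian s t‖ := by
  rw [cauchyKernel_add_neg hs, intervalIntegral.integral_of_le (by linarith)]
  calc _ ≤ ∫ t in Set.Ioc (-T) T, ‖lorentzian s t * Complex.exp (-(t * Complex.I) * x)‖ :=
        norm_integral_le_integral_norm _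
    _ = ∫ t in Set.Ioc (-T) T, ‖lorentzian s t‖ := by
        simp only [norm_mul, norm_exp_neg_mul_I_mul, mul_one]
    _ ≤ ∫ t, ‖lorentzian s t‖ := setIntegral_le_integral (integrable_lorentzian hs).norm
        (Eventually.of_forall fun t => norm_nonneg _)

/-- An oscillatory integral against a slowly varying function is small. -/
theorem norm_integral_mul_exp_le {v v' : ℝ → ℂ} {D E a T y : ℝ} (ha : 0 < a) (haT : a ≤ T)
    (hy : y ≠ 0) (hv : ∀ t, HasDerivAt v (v' t) t) (hv' : Continuous v')
    (hD : ∀ t, a ≤ t → ‖v t‖ ≤ D / t) (hE : ∀ t, a ≤ t → ‖v' t‖ ≤ E / t ^ 2) (hE0 : 0 ≤ E) :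
    ‖∫ t in a..T, v t * Complex.exp (-(t * Complex.I) * y)‖ ≤ (2 * D + E) / (|y| * a) := by
  have hy' : (y : ℂ) ≠ 0 := by exact_mod_cast hy
  have hyI : (Complex.I * y : ℂ) ≠ 0 := mul_ne_zero Complex.I_ne_zero hy'
  have hyp : 0 < |y| := abs_pos.2 hy
  have hn : ‖(Complex.I * y : ℂ)‖ = |y| := by simp
  have hD0 : 0 ≤ D := by
    have := (norm_nonneg _).trans (hD a le_rfl)
    rwa [le_div_iff₀ ha, zero_mul] at this
  set w : ℝ → ℂ := fun t => Complex.exp (-(t * Complex.I) * y) / -(Complex.I * y)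
  have hw : ∀ t : ℝ, HasDerivAt w (Complex.exp (-(t * Complex.I) * y)) t := by
    intro t
    have h1 : HasDerivAt (fun t : ℝ => -(t * Complex.I) * (y : ℂ)) (-(Complex.I * y)) t := by
      have := (((Complex.ofRealCLM.hasDerivAt (x := t)).mul_const Complex.I).neg).mul_const (y : ℂ)
      simpa using this
    refine (h1.cexp.div_const (-(Complex.I * y))).congr_deriv ?_
    field_simp
  have hwn : ∀ t, ‖w t‖ = 1 / |y| := fun t => by
    simp only [w]
    rw [norm_div, norm_exp_neg_mul_I_mul, norm_neg, hn]
  have hwc : Continuous w := continuous_iff_continuousAt.2 fun t => (hw t).continuousAt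
  -- Integration by parts gains the factor 1/|y| from the primitive `w`; the boundary terms
  -- contribute 2D and the integral of E / t² contributes E.
  rw [intervalIntegral.integral_mul_deriv_eq_deriv_mul (fun t _ => hv t) (fun t _ => hw t)
    (hv'.intervalIntegrable _ _) (Continuous.intervalIntegrable (by fun_prop) _ _)]
  have hT : 0 < T := ha.trans_le haT
  have b1 : ‖v T * w T‖ ≤ D / (|y| * a) := by
    rw [norm_mul, hwn]
    calc ‖v T‖ * (1 / |y|) ≤ D / a * (1 / |y|) := by
          gcongr
          exact (hD T haT).trans (by gcongr)
      _ = D / (|y| * a) := by field_simp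
  have b2 : ‖v a * w a‖ ≤ D / (|y| * a) := by
    rw [norm_mul, hwn]
    calc ‖v a‖ * (1 / |y|) ≤ D / a * (1 / |y|) := by gcongr; exact hD a le_rfl
      _ = D / (|y| * a) := by field_simp
  have b3 : ‖∫ t in a..T, v' t * w t‖ ≤ E / (|y| * a) := by
    have hpos : ∀ t ∈ Set.uIcc a T, t ≠ 0 := fun t ht => by
      rw [Set.uIcc_of_le haT] at ht; exact (ha.trans_le ht.1).ne'
    have hci : IntervalIntegrable (fun t : ℝ => E / |y| * (1 / t ^ 2)) volume a T := by
      refine ContinuousOn.intervalIntegrable (continuousOn_const.mul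
        (continuousOn_const.div (by fun_prop) fun t ht => pow_ne_zero _ (hpos t ht)))
    calc ‖∫ t in a..T, v' t * w t‖ ≤ ∫ t in a..T, E / |y| * (1 / t ^ 2) := by
          refine intervalIntegral.norm_integral_le_of_norm_le haT
            (Eventually.of_forall fun t ht => ?_) hci
          rw [norm_mul, hwn]
          calc ‖v' t‖ * (1 / |y|) ≤ E / t ^ 2 * (1 / |y|) := by gcongr; exact hE t ht.1.le
            _ = E / |y| * (1 / t ^ 2) := by field_simp
      _ = E / |y| * (-(1 / T)) - E / |y| * (-(1 / a)) := by
          refine intervalIntegral.integral_eq_sub_of_hasDerivAt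
            (f := fun t => E / |y| * (-(1 / t))) (fun t ht => ?_) hci
          refine HasDerivAt.const_mul _ ?_
          simpa using (hasDerivAt_inv (hpos t ht)).fun_neg
      _ ≤ E / |y| * (1 / a) := by
          have : 0 ≤ E / |y| * (1 / T) := by positivity
          linarith
      _ = E / (|y| * a) := by field_simp
  calc _ ≤ ‖v T * w T‖ + ‖v a * w a‖ + ‖∫ t in a..T, v' t * w t‖ :=
        (norm_sub_le _ _).trans (by gcongr; exact norm_sub_le _ _)
    _ ≤ D / (|y| * a) + D / (|y| * a) + E / (|y| * a) := by gcongr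
    _ = (2 * D + E) / (|y| * a) := by ring

theorem norm_integral_tail_le {s : ℂ} (hs : 0 < s.re) {c : ℝ} (hc : 0 < c)
    (h : ∀ t : ℝ, c * (1 + |t|) ≤ ‖s - t * Complex.I‖) {a T y : ℝ} (ha : 0 < a) (haT : a ≤ T)
    (hy : y ≠ 0) {ε : ℝ} (hε : |ε| = 1) :
    ‖∫ t in a..T, 1 / (s - (ε * t : ℝ) * Complex.I) * Complex.exp (-(t * Complex.I) * y)‖
      ≤ (2 * (1 / c) + (1 / c) ^ 2) / (|y| * a) := by
  have hb : ∀ t, a ≤ t → ‖1 / (s - (ε * t : ℝ) * Complex.I)‖ ≤ 1 / c / t := by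
    intro t ht
    have ht0 : 0 < t := ha.trans_le ht
    refine (norm_one_div_sub_mul_I_le hc h (ε * t)).trans ?_
    rw [abs_mul, hε, one_mul, abs_of_pos ht0, div_div]
    gcongr; linarith
  refine norm_integral_mul_exp_le (v := fun t : ℝ => 1 / (s - (ε * t : ℝ) * Complex.I))
    (v' := fun t : ℝ => ε * Complex.I * (1 / (s - (ε * t : ℝ) * Complex.I)) ^ 2) ha haT hy
    ?_ ?_ hb ?_ (by positivity)
  · intro t
    have h1 : HasDerivAt (fun t : ℝ => s - (ε * t : ℝ) * Complex.I) (-(ε * Complex.I)) t := by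
      have := (((Complex.ofRealCLM.hasDerivAt (x := t)).const_mul (ε : ℂ)).mul_const
        Complex.I).const_sub s
      simpa using this
    have h2 := h1.fun_inv (sub_mul_I_ne_zero hs _)
    simp only [one_div]
    refine h2.congr_deriv ?_
    rw [neg_neg, inv_pow, div_eq_mul_inv]
  · exact continuous_const.mul (((continuous_one_div_sub_mul_I hs).comp
      (continuous_const.mul continuous_id)).pow 2)
  · intro t ht
    rw [norm_mul, norm_mul, norm_pow, Complex.norm_real, Real.norm_eq_abs, hε, Complex.norm_I,
      mul_one, one_mul, ← div_pow]
    gcongr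
    exact hb t ht

/-- This is the dominating constant for every later limit. If |x| T ≤ 1, the exponential is close to
1 and the kernel is compared with its value at x = 0, where only the integrable even part counts.
Otherwise the range is cut at |t| = 1/|x|: the centre is the previous case, and oscillation bounds
both tails independently of x. -/
theorem cauchyKernel_uniformly_bounded {s : ℂ} (hs : 0 < s.re) :
    ∃ M : ℝ, ∀ T x : ℝ, 0 ≤ T → ‖cauchyKernel s T x‖ ≤ M := by
  obtain ⟨c, hc, h⟩ := exists_norm_sub_mul_I_lower hs
  set J := ∫ t, ‖lorentzian s t‖
  have small : ∀ T x : ℝ, 0 ≤ T → |x| * T ≤ 1 → ‖cauchyKernel s T x‖ ≤ J + 2 / c := by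
    intro T x hT hx
    have h0 : ‖cauchyKernel s T 0‖ ≤ J := by
      have := norm_cauchyKernel_add_neg_le hs hT 0
      rw [neg_zero, ← two_mul, norm_mul, Complex.norm_ofNat] at this
      linarith [norm_nonneg (cauchyKernel s T 0)]
    have h1 : ‖cauchyKernel s T x - cauchyKernel s T 0‖ ≤ 2 / c := by
      rw [cauchyKernel, cauchyKernel, ← intervalIntegral.integral_sub
        (intervalIntegrable_cauchyKernel hs x _ _) (intervalIntegrable_cauchyKernel hs 0 _ _)]
      calc _ ≤ (|x| / c) * |T - -T| := by
            refine intervalIntegral.norm_integral_le_of_norm_le_const fun t _ => ?_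
            rw [← mul_sub, norm_mul]
            have e1 : ‖Complex.exp (-(t * Complex.I) * x)
                - Complex.exp (-(t * Complex.I) * ((0 : ℝ) : ℂ))‖ ≤ |t| * |x| := by
              have := Real.norm_exp_I_mul_ofReal_sub_one_le (x := -(t * x))
              simp only [norm_neg, norm_mul, Real.norm_eq_abs] at this
              convert this using 3
              · push_cast; ring_nf
              · simp
            calc _ ≤ 1 / (c * (1 + |t|)) * (|t| * |x|) := by
                  gcongr
                  exact norm_one_div_sub_mul_I_le hc h t
              _ ≤ 1 / (c * (1 + |t|)) * ((1 + |t|) * |x|) := by gcongr; linarith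
              _ = |x| / c := by field_simp
        _ = 2 * (|x| * T) / c := by rw [abs_of_nonneg (a := T - -T) (by linarith)]; ring
        _ ≤ 2 / c := by gcongr; linarith
    calc ‖cauchyKernel s T x‖ = ‖cauchyKernel s T 0 + (cauchyKernel s T x - cauchyKernel s T 0)‖ := by
          congr 1; ring
      _ ≤ J + 2 / c := (norm_add_le _ _).trans (add_le_add h0 h1)
  set E := 2 * (1 / c) + (1 / c) ^ 2
  have hE : 0 ≤ E := by positivity
  refine ⟨J + 2 / c + E + E, fun T x hT => ?_⟩
  rcases le_or_gt (|x| * T) 1 with hx | hx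
  · linarith [small T x hT hx]
  have hx0 : x ≠ 0 := by rintro rfl; simp at hx; linarith
  have hxp : 0 < |x| := abs_pos.2 hx0
  set a := 1 / |x|
  have ha : 0 < a := by positivity
  have hxa : |x| * a = 1 := by simp only [a]; field_simp
  have haT : a ≤ T := by
    by_contra hcon
    have := mul_lt_mul_of_pos_left (not_le.1 hcon) hxp
    linarith
  have hint := intervalIntegrable_cauchyKernel hs x
  have hsplit : cauchyKernel s T x = cauchyKernel s a x
      + (∫ t in a..T, 1 / (s - t * Complex.I) * Complex.exp (-(t * Complex.I) * x))
      + ∫ t in (-T)..(-a), 1 / (s - t * Complex.I) * Complex.exp (-(t * Complex.I) * x) := by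
    rw [cauchyKernel, cauchyKernel,
      ← intervalIntegral.integral_add_adjacent_intervals (hint (-T) (-a)) (hint (-a) T),
      ← intervalIntegral.integral_add_adjacent_intervals (hint (-a) a) (hint a T)]
    ring
  have t1 := norm_integral_tail_le hs hc h ha haT hx0 (ε := 1) (by simp)
  have t2 := norm_integral_tail_le hs hc h ha haT (neg_ne_zero.2 hx0) (ε := -1) (by simp)
  rw [abs_neg] at t2
  rw [hxa, div_one] at t1 t2
  -- Reflecting the left tail turns it into a right tail with ε = -1 and frequency -x.
  have e2 : ∫ t in (-T)..(-a), 1 / (s - t * Complex.I) * Complex.exp (-(t * Complex.I) * x)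
      = ∫ t in a..T, 1 / (s - (-1 * t : ℝ) * Complex.I)
          * Complex.exp (-(t * Complex.I) * ((-x : ℝ) : ℂ)) := by
    rw [← intervalIntegral.integral_comp_neg]
    refine intervalIntegral.integral_congr fun t _ => ?_
    push_cast
    ring_nf
  simp only [one_mul] at t1
  rw [hsplit, e2]
  refine (norm_add_le _ _).trans (add_le_add ((norm_add_le _ _).trans (add_le_add ?_ t1)) t2)
  exact small a x ha.le hxa.le

theorem tendsto_cauchyKernel_zero {s : ℂ} (hs : 0 < s.re) :
    Tendsto (fun T => cauchyKernel s T 0) atTop (𝓝 (Real.pi : ℂ)) := by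
  -- Dividing by T inside the logarithm changes the primitive only by a constant and keeps its
  -- endpoint values convergent, to log(-i) and log(i).
  have hprim : ∀ T : ℝ, 0 < T → cauchyKernel s T 0
      = Complex.I * (Complex.log (s / T - Complex.I) - Complex.log (s / T + Complex.I)) := by
    intro T hT
    have hT' : (T : ℂ) ≠ 0 := by exact_mod_cast hT.ne'
    have hslit : ∀ t : ℝ, s / T - t * Complex.I ∈ Complex.slitPlane := fun t => by
      refine Complex.mem_slitPlane_iff.2 (Or.inl ?_)
      simp [Complex.div_ofReal_re]; positivity
    have hd : ∀ t : ℝ, HasDerivAt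
        (fun t : ℝ => Complex.I * Complex.log (s / T - (t / T : ℝ) * Complex.I))
        (1 / (s - t * Complex.I)) t := by
      intro t
      have h1 : HasDerivAt (fun t : ℝ => s / T - (t / T : ℝ) * Complex.I) (-(Complex.I / T)) t := by
        have := (((Complex.ofRealCLM.hasDerivAt (x := t)).div_const (T : ℂ)).mul_const
          Complex.I).const_sub (s / T)
        refine (this.congr_deriv ?_).congr_of_eventuallyEq (Eventually.of_forall fun x => ?_)
        · simp; ring
        · simp
      refine ((h1.clog_real (hslit _)).const_mul Complex.I).congr_deriv ?_
      have h2 : s / T - (t / T : ℝ) * Complex.I = (s - t * Complex.I) / T := by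
        push_cast; field_simp
      have h3 := sub_mul_I_ne_zero hs t
      rw [h2]
      generalize s - t * Complex.I = d at *
      field_simp
      simp
    have := intervalIntegral.integral_eq_sub_of_hasDerivAt (a := -T) (b := T) (fun t _ => hd t)
      ((continuous_one_div_sub_mul_I hs).intervalIntegrable _ _)
    rw [cauchyKernel]
    simp only [Complex.ofReal_zero, mul_zero, Complex.exp_zero, mul_one]
    rw [this, div_self hT.ne', neg_div, div_self hT.ne']
    push_cast
    ring_nf
  have h0 : Tendsto (fun T : ℝ => s / (T : ℂ)) atTop (𝓝 0) := by
    have : Tendsto (fun T : ℝ => s * ((T⁻¹ : ℝ) : ℂ)) atTop (𝓝 (s * ((0 : ℝ) : ℂ))) :=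
      (Complex.continuous_ofReal.tendsto _ |>.comp tendsto_inv_atTop_zero).const_mul s
    simpa [div_eq_mul_inv] using this
  have hm : Tendsto (fun T : ℝ => Complex.log (s / T - Complex.I)) atTop
      (𝓝 (Complex.log (-Complex.I))) := by
    refine (continuousAt_clog ?_).tendsto.comp ?_
    · exact Complex.mem_slitPlane_iff.2 (Or.inr (by simp))
    · simpa using h0.sub_const Complex.I
  have hp : Tendsto (fun T : ℝ => Complex.log (s / T + Complex.I)) atTop
      (𝓝 (Complex.log Complex.I)) := by
    refine (continuousAt_clog ?_).tendsto.comp ?_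
    · exact Complex.mem_slitPlane_iff.2 (Or.inr (by simp))
    · simpa using h0.add_const Complex.I
  have := (hm.sub hp).const_mul Complex.I
  rw [Complex.log_neg_I, Complex.log_I] at this
  have e : Complex.I * (-(Real.pi / 2) * Complex.I - Real.pi / 2 * Complex.I) = Real.pi := by
    linear_combination (-(Real.pi : ℂ)) * Complex.I_mul_I
  rw [e] at this
  refine this.congr' ?_
  filter_upwards [eventually_gt_atTop 0] with T hT using (hprim T hT).symm

theorem tendsto_integral_exp_mul_I {f : ℝ → ℂ} {l : Filter ℝ} {κ : ℝ → ℝ}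
    (hκ : Tendsto κ l (cocompact ℝ)) (x y : ℝ) :
    Tendsto (fun T => ∫ u in x..y, f u * Complex.exp (-(κ T * Complex.I) * u)) l (𝓝 0) := by
  have key : ∀ x y : ℝ,
      Tendsto (fun T => ∫ u in Set.Ioc x y, f u * Complex.exp (-(κ T * Complex.I) * u)) l
        (𝓝 0) := by
    intro x y
    have h1 : Tendsto (fun T => κ T * (2 * Real.pi)⁻¹) l (cocompact ℝ) := by
      have : Tendsto (fun r : ℝ => r * (2 * Real.pi)⁻¹) (cocompact ℝ) (cocompact ℝ) :=
        (Homeomorph.mulRight₀ _ (by positivity)).isClosedEmbedding.tendsto_cocompact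
      exact this.comp hκ
    refine ((Real.tendsto_integral_exp_smul_cocompact
      ((Set.Ioc x y).indicator f)).comp h1).congr fun T => ?_
    rw [← integral_indicator measurableSet_Ioc]
    refine integral_congr_ae (Eventually.of_forall fun u => ?_)
    by_cases hu : u ∈ Set.Ioc x y
    · simp only [Set.indicator_of_mem hu, Circle.smul_def, Real.fourierChar_apply, smul_eq_mul]
      rw [mul_comm]
      congr 2
      push_cast
      have : (Real.pi : ℂ) ≠ 0 := by exact_mod_cast Real.pi_ne_zero
      field_simp
    · simp [Set.indicator_of_notMem hu]
  simpa [intervalIntegral] using (key x y).sub (key y x)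

/-- The x-derivative of e^{sx} K_T(x) is the integral of e^{(s-it)x} over [-T, T], which is e^{sx}/x
times an oscillation of frequency T. Away from x = 0 its integral vanishes in the limit by
Riemann-Lebesgue. Thus any limit of K_T(x) is a constant multiple of e^{-sx} on each half-line. -/
theorem tendsto_exp_mul_cauchyKernel_sub {s : ℂ} (hs : 0 < s.re) {x y : ℝ}
    (hxy : (0 : ℝ) ∉ Set.uIcc y x) :
    Tendsto (fun T => Complex.exp (s * x) * cauchyKernel s T x
      - Complex.exp (s * y) * cauchyKernel s T y) atTop (𝓝 0) := by
  have hne : ∀ u ∈ Set.uIcc y x, (u : ℂ) ≠ 0 := fun u hu h =>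
    hxy (by rwa [Complex.ofReal_eq_zero.1 h] at hu)
  have hform : ∀ T : ℝ, Complex.exp (s * x) * cauchyKernel s T x
      - Complex.exp (s * y) * cauchyKernel s T y
      = (∫ u in y..x, Complex.I * Complex.exp (s * u) / u * Complex.exp (-(T * Complex.I) * u))
        - ∫ u in y..x, Complex.I * Complex.exp (s * u) / u
            * Complex.exp (-((-T : ℝ) * Complex.I) * u) := by
    intro T
    have e1 : ∀ t : ℝ, ∫ u in y..x, Complex.exp ((s - t * Complex.I) * u)
        = Complex.exp (s * x) * (1 / (s - t * Complex.I) * Complex.exp (-(t * Complex.I) * x))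
          - Complex.exp (s * y) * (1 / (s - t * Complex.I) * Complex.exp (-(t * Complex.I) * y)) := by
      intro t
      have h1 : ∀ r : ℝ, Complex.exp ((s - t * Complex.I) * r)
          = Complex.exp (s * r) * Complex.exp (-(t * Complex.I) * r) := fun r => by
        rw [← Complex.exp_add]; ring_nf
      rw [integral_exp_mul_complex (sub_mul_I_ne_zero hs t), h1, h1]
      ring
    have e2 : ∀ u : ℝ, u ∈ Set.uIcc y x → ∫ t in (-T)..T, Complex.exp ((s - t * Complex.I) * u)
        = Complex.I * Complex.exp (s * u) / u * Complex.exp (-(T * Complex.I) * u)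
          - Complex.I * Complex.exp (s * u) / u * Complex.exp (-((-T : ℝ) * Complex.I) * u) := by
      intro u hu
      have h1 : ∀ t : ℝ, Complex.exp ((s - t * Complex.I) * u)
          = Complex.exp (s * u) * Complex.exp ((-(Complex.I * u)) * t) := fun r => by
        rw [← Complex.exp_add]; ring_nf
      have hu0 := hne u hu
      simp_rw [h1]
      rw [intervalIntegral.integral_const_mul, integral_exp_mul_complex
        (neg_ne_zero.2 (mul_ne_zero Complex.I_ne_zero hu0))]
      have h2 : ∀ r : ℝ, -(Complex.I * u) * (r : ℂ) = -(r * Complex.I) * u := fun r => by ring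
      rw [h2, h2]
      field_simp
      rw [Complex.I_sq]; ring
    have hc : ∀ z : ℝ, IntervalIntegrable (fun t : ℝ => Complex.exp (s * z)
        * (1 / (s - t * Complex.I) * Complex.exp (-(t * Complex.I) * z))) volume (-T) T := fun z =>
      (intervalIntegrable_cauchyKernel hs z _ _).const_mul _
    rw [cauchyKernel, cauchyKernel, ← intervalIntegral.integral_const_mul,
      ← intervalIntegral.integral_const_mul, ← intervalIntegral.integral_sub (hc x) (hc y)]
    simp_rw [← e1]
    rw [intervalIntegral_intervalIntegral_swap]
    · rw [← intervalIntegral.integral_sub]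
      · exact intervalIntegral.integral_congr fun u hu => e2 u hu
      all_goals
        refine ContinuousOn.intervalIntegrable (ContinuousOn.mul
          (ContinuousOn.div (by fun_prop) (by fun_prop) hne) (by fun_prop))
    · refine IntegrableOn.mono_set ?_ (Set.prod_mono Set.uIoc_subset_uIcc Set.uIoc_subset_uIcc)
      refine ContinuousOn.integrableOn_compact (isCompact_uIcc.prod isCompact_uIcc) ?_
      simp only [Function.uncurry_def]
      fun_prop
  have hT1 : Tendsto (fun T : ℝ => T) atTop (cocompact ℝ) := atTop_le_cocompact
  have hT2 : Tendsto (fun T : ℝ => -T) atTop (cocompact ℝ) :=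
    tendsto_neg_atTop_atBot.trans atBot_le_cocompact
  have := (tendsto_integral_exp_mul_I (f := fun u => Complex.I * Complex.exp (s * u) / u)
    hT1 y x).sub (tendsto_integral_exp_mul_I (f := fun u => Complex.I * Complex.exp (s * u) / u)
    hT2 y x)
  rw [sub_zero] at this
  exact this.congr fun T => (hform T).symm

theorem tendsto_cauchyKernel_of_neg {s : ℂ} (hs : 0 < s.re) {x : ℝ} (hx : x < 0) :
    Tendsto (fun T => cauchyKernel s T x) atTop (𝓝 0) := by
  obtain ⟨M, hM⟩ := cauchyKernel_uniformly_bounded hs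
  rw [Metric.tendsto_atTop']
  intro ε hε
  -- The value at x is transported from a point y far to the left, where the uniform bound is
  -- multiplied by the small factor e^{Re s (y - x)}.
  have hlim : Tendsto (fun y : ℝ => Real.exp (s.re * (y - x)) * M) atBot (𝓝 (0 * M)) := by
    refine (Real.tendsto_exp_atBot.comp ?_).mul_const M
    exact (tendsto_atBot_add_const_right _ _ tendsto_id).const_mul_atBot hs
  rw [zero_mul] at hlim
  obtain ⟨y, hyε, hyx⟩ := ((hlim.eventually (gt_mem_nhds (half_pos hε))).and
    (eventually_lt_atBot x)).exists
  have h0 : (0 : ℝ) ∉ Set.uIcc y x := by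
    rw [Set.uIcc_of_le hyx.le]; exact fun h => absurd h.2 (not_le.2 hx)
  have hd := (tendsto_exp_mul_cauchyKernel_sub hs h0).const_mul (Complex.exp (-(s * x)))
  rw [mul_zero] at hd
  have hd' := Metric.tendsto_atTop'.1 hd (ε / 2) (half_pos hε)
  obtain ⟨T₀, hT₀⟩ := hd'
  refine ⟨max T₀ 0, fun T hT => ?_⟩
  have h1 := hT₀ T ((le_max_left _ _).trans_lt hT)
  rw [dist_zero_right] at h1 ⊢
  have e : cauchyKernel s T x = Complex.exp (-(s * x)) * (Complex.exp (s * x) * cauchyKernel s T x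
      - Complex.exp (s * y) * cauchyKernel s T y)
      + Complex.exp (s * (y - x)) * cauchyKernel s T y := by
    rw [mul_sub, ← mul_assoc, ← mul_assoc, ← Complex.exp_add, ← Complex.exp_add,
      neg_add_cancel, Complex.exp_zero]
    ring_nf
  have h2 : ‖Complex.exp (s * (y - x)) * cauchyKernel s T y‖ ≤ Real.exp (s.re * (y - x)) * M := by
    rw [norm_mul, Complex.norm_exp]
    have : (s * ((y : ℂ) - x)).re = s.re * (y - x) := by simp
    rw [this]
    gcongr
    exact hM T y ((le_max_right _ _).trans hT.le)
  rw [e]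
  linarith [norm_add_le (Complex.exp (-(s * x)) * (Complex.exp (s * x) * cauchyKernel s T x
      - Complex.exp (s * y) * cauchyKernel s T y)) (Complex.exp (s * (y - x)) * cauchyKernel s T y)]

/-- The Fourier transform of the Lorentzian. -/
noncomputable def lorentzianFourier (s : ℂ) (x : ℝ) : ℂ :=
  ∫ t, lorentzian s t * Complex.exp (-(t * Complex.I) * x)

theorem tendsto_cauchyKernel_add_neg {s : ℂ} (hs : 0 < s.re) (x : ℝ) :
    Tendsto (fun T => cauchyKernel s T x + cauchyKernel s T (-x)) atTop
      (𝓝 (lorentzianFourier s x)) := by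
  simp_rw [cauchyKernel_add_neg hs]
  exact intervalIntegral_tendsto_integral (integrable_lorentzian_mul_exp hs x)
    tendsto_neg_atTop_atBot tendsto_id

theorem continuous_lorentzianFourier {s : ℂ} (hs : 0 < s.re) :
    Continuous (lorentzianFourier s) := by
  refine continuous_of_dominated (bound := fun t => ‖lorentzian s t‖)
    (fun x => (integrable_lorentzian_mul_exp hs x).aestronglyMeasurable)
    (fun x => Eventually.of_forall fun t => ?_) (integrable_lorentzian hs).norm
    (Eventually.of_forall fun t => by fun_prop)
  rw [norm_mul, norm_exp_neg_mul_I_mul, mul_one]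

/-- The kernel at -x tends to 0, so the limit at x is that of the symmetrised kernel, the Fourier
transform of the Lorentzian. This is continuous up to x = 0, where it equals π + π, and that fixes
the constant in front of e^{-sx}. -/
theorem tendsto_cauchyKernel_of_pos {s : ℂ} (hs : 0 < s.re) {x : ℝ} (hx : 0 < x) :
    Tendsto (fun T => cauchyKernel s T x) atTop (𝓝 (2 * Real.pi * Complex.exp (-s * x))) := by
  have h1 : ∀ x : ℝ, 0 < x →
      Tendsto (fun T => cauchyKernel s T x) atTop (𝓝 (lorentzianFourier s x)) := fun x hx => by
    simpa using (tendsto_cauchyKernel_add_neg hs x).sub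
      (tendsto_cauchyKernel_of_neg hs (neg_neg_iff_pos.2 hx))
  have h2 : ∀ y : ℝ, 0 < y → Complex.exp (s * x) * lorentzianFourier s x
      = Complex.exp (s * y) * lorentzianFourier s y := fun y hy => by
    have h0 : (0 : ℝ) ∉ Set.uIcc y x := fun h => by
      have := h.1
      rcases min_le_iff.1 this with h | h <;> linarith
    exact sub_eq_zero.1 (tendsto_nhds_unique
      (((h1 x hx).const_mul _).sub ((h1 y hy).const_mul _))
      (tendsto_exp_mul_cauchyKernel_sub hs h0))
  have h3 : lorentzianFourier s 0 = 2 * Real.pi := by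
    refine tendsto_nhds_unique (tendsto_cauchyKernel_add_neg hs 0) ?_
    simpa [two_mul] using (tendsto_cauchyKernel_zero hs).add (tendsto_cauchyKernel_zero hs)
  have h4 : Tendsto (fun y : ℝ => Complex.exp (s * y) * lorentzianFourier s y) (𝓝[>] 0)
      (𝓝 (2 * Real.pi)) := by
    have hc : Continuous fun y : ℝ => Complex.exp (s * y) * lorentzianFourier s y :=
      (by fun_prop : Continuous fun y : ℝ => Complex.exp (s * y)).mul
        (continuous_lorentzianFourier hs)
    have := (hc.tendsto 0).mono_left (nhdsWithin_le_nhds (s := Set.Ioi 0))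
    simpa [h3] using this
  have h5 : Complex.exp (s * x) * lorentzianFourier s x = 2 * Real.pi := by
    refine tendsto_nhds_unique (tendsto_const_nhds.congr' ?_) h4
    filter_upwards [self_mem_nhdsWithin] with y hy using h2 y hy
  have h6 : lorentzianFourier s x = 2 * Real.pi * Complex.exp (-s * x) := by
    rw [← h5, mul_comm (Complex.exp (s * x)), mul_assoc, ← Complex.exp_add]
    simp
  rw [← h6]
  exact h1 x hx

/-! ### Principal value integrals of weighted characteristic functions and of their series. -/

section PV

variable {Ω : Type*} [MeasurableSpace Ω] (Pr : Measure Ω) [IsProbabilityMeasure Pr]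

/-- A weighted characteristic function. -/
noncomputable def weightedCharFun (W : Ω → ℂ) (X : Ω → ℝ) (t : ℝ) : ℂ :=
  ∫ ω, W ω * Complex.exp (-(t * Complex.I) * X ω) ∂Pr

variable {Pr} {W : Ω → ℂ} {X : Ω → ℝ}

theorem ae_norm_mul_exp_le {m : Measure Ω} (hW1 : ∀ᵐ ω ∂m, ‖W ω‖ ≤ 1) (t : ℝ) :
    ∀ᵐ ω ∂m, ‖W ω * Complex.exp (-(t * Complex.I) * X ω)‖ ≤ 1 := by
  filter_upwards [hW1] with ω hω
  rwa [norm_mul, norm_exp_neg_mul_I_mul, mul_one]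

theorem norm_weightedCharFun_le (hW1 : ∀ᵐ ω ∂Pr, ‖W ω‖ ≤ 1) (t : ℝ) :
    ‖weightedCharFun Pr W X t‖ ≤ 1 := by
  rw [weightedCharFun]
  simpa only [probReal_univ, mul_one] using
    norm_integral_le_of_norm_le_const (ae_norm_mul_exp_le (X := X) hW1 t)

theorem continuous_weightedCharFun (hW : Measurable W) (hX : Measurable X)
    (hW1 : ∀ᵐ ω ∂Pr, ‖W ω‖ ≤ 1) : Continuous (weightedCharFun Pr W X) := by
  refine continuous_of_dominated (bound := fun _ => 1)
    (fun t => (by fun_prop : Measurable fun ω =>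
      W ω * Complex.exp (-(t * Complex.I) * X ω)).aestronglyMeasurable)
    (fun t => ae_norm_mul_exp_le hW1 t) (integrable_const _) (Eventually.of_forall fun ω => ?_)
  fun_prop

theorem integral_weightedCharFun {s : ℂ} (hs : 0 < s.re) (hW : Measurable W) (hX : Measurable X)
    (hW1 : ∀ᵐ ω ∂Pr, ‖W ω‖ ≤ 1) (T : ℝ) :
    ∫ t in (-T)..T, 1 / (s - t * Complex.I) * weightedCharFun Pr W X t
      = ∫ ω, W ω * cauchyKernel s T (X ω) ∂Pr := by
  obtain ⟨c, hc, h⟩ := exists_norm_sub_mul_I_lower hs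
  simp_rw [weightedCharFun, ← integral_const_mul]
  rw [intervalIntegral_integral_swap]
  · refine integral_congr_ae (Eventually.of_forall fun ω => ?_)
    simp only [cauchyKernel]
    rw [← intervalIntegral.integral_const_mul]
    refine intervalIntegral.integral_congr fun t _ => ?_
    ring
  · have : IsFiniteMeasure (volume.restrict (Set.uIoc (-T) T)) :=
      Real.isFiniteMeasure_restrict_Ioc _ _
    refine Integrable.of_bound (C := 1 / c) ?_ ?_
    · have h1 : Measurable fun t : ℝ => 1 / (s - t * Complex.I) :=
        (continuous_one_div_sub_mul_I hs).measurable
      refine Measurable.aestronglyMeasurable ?_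
      simp only [Function.uncurry_def]
      fun_prop
    · filter_upwards [Measure.quasiMeasurePreserving_snd.ae hW1] with p hp
      simp only [Function.uncurry_def]
      rw [norm_mul, norm_mul, norm_exp_neg_mul_I_mul, mul_one]
      calc _ ≤ 1 / (c * (1 + |p.1|)) * 1 := by
            gcongr
            exact norm_one_div_sub_mul_I_le hc h p.1
        _ ≤ 1 / c := by
            rw [mul_one]
            exact one_div_le_one_div_of_le hc (by nlinarith [abs_nonneg p.1])

theorem tendsto_integral_mul_cauchyKernel {s : ℂ} (hs : 0 < s.re) (hW : Measurable W)
    (hX : Measurable X) (hW1 : ∀ᵐ ω ∂Pr, ‖W ω‖ ≤ 1) (hX0 : ∀ᵐ ω ∂Pr, X ω ≠ 0) :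
    Tendsto (fun T => ∫ ω, W ω * cauchyKernel s T (X ω) ∂Pr) atTop
      (𝓝 (∫ ω, {ω | 0 < X ω}.indicator
        (fun ω => 2 * Real.pi * (W ω * Complex.exp (-s * X ω))) ω ∂Pr)) := by
  obtain ⟨M, hM⟩ := cauchyKernel_uniformly_bounded hs
  refine tendsto_integral_filter_of_dominated_convergence (fun _ => M) ?_ ?_
    (integrable_const _) ?_
  · refine Eventually.of_forall fun T => ?_
    have hcont : Continuous (cauchyKernel s T) := by
      refine intervalIntegral.continuous_parametric_intervalIntegral_of_continuous' ?_ _ _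
      exact ((continuous_one_div_sub_mul_I hs).comp continuous_snd).mul (by fun_prop)
    exact (hW.mul (hcont.measurable.comp hX)).aestronglyMeasurable
  · filter_upwards [eventually_ge_atTop 0] with T hT
    filter_upwards [hW1] with ω hω
    rw [norm_mul]
    calc _ ≤ 1 * M := by gcongr; exact hM _ _ hT
      _ = M := one_mul M
  · filter_upwards [hX0] with ω hω
    rcases lt_or_gt_of_ne hω with h | h
    · rw [Set.indicator_of_notMem (by simpa using h.le)]
      simpa using (tendsto_cauchyKernel_of_neg hs h).const_mul (W ω)
    · rw [Set.indicator_of_mem (by simpa using h)]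
      convert (tendsto_cauchyKernel_of_pos hs h).const_mul (W ω) using 2
      ring

theorem norm_integral_mul_cauchyKernel_le {s : ℂ} {M : ℝ}
    (hM : ∀ T x : ℝ, 0 ≤ T → ‖cauchyKernel s T x‖ ≤ M)
    (hW1 : ∀ᵐ ω ∂Pr, ‖W ω‖ ≤ 1) {T : ℝ} (hT : 0 ≤ T) :
    ‖∫ ω, W ω * cauchyKernel s T (X ω) ∂Pr‖ ≤ M := by
  have := norm_integral_le_of_norm_le_const (μ := Pr)
    (f := fun ω => W ω * cauchyKernel s T (X ω)) (C := M) ?_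
  · simpa using this
  filter_upwards [hW1] with ω hω
  rw [norm_mul]
  calc _ ≤ 1 * M := by gcongr; exact hM _ _ hT
    _ = M := one_mul M

end PV

section Series

variable {Ω : Type*} [MeasurableSpace Ω] {Pr : Measure Ω} [IsProbabilityMeasure Pr]
  {W : ℕ → Ω → ℂ} {X : ℕ → Ω → ℝ} {c : ℕ → ℂ}

theorem continuous_tsum_weightedCharFun (hc : Summable fun n => ‖c n‖)
    (hW : ∀ n, Measurable (W n)) (hX : ∀ n, Measurable (X n))
    (hW1 : ∀ n, ∀ᵐ ω ∂Pr, ‖W n ω‖ ≤ 1) :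
    Continuous fun t => ∑' n, c n * weightedCharFun Pr (W n) (X n) t := by
  refine continuous_tsum (fun n => continuous_const.mul
    (continuous_weightedCharFun (hW n) (hX n) (hW1 n))) hc fun n t => ?_
  rw [norm_mul]
  exact mul_le_of_le_one_right (norm_nonneg _) (norm_weightedCharFun_le (hW1 n) t)

theorem tendsto_integral_tsum_weightedCharFun {s : ℂ} (hs : 0 < s.re)
    (hc : Summable fun n => ‖c n‖)
    (hW : ∀ n, Measurable (W n)) (hX : ∀ n, Measurable (X n))
    (hW1 : ∀ n, ∀ᵐ ω ∂Pr, ‖W n ω‖ ≤ 1) (hX0 : ∀ n, c n ≠ 0 → ∀ᵐ ω ∂Pr, X n ω ≠ 0) :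
    Tendsto (fun T : ℝ => ∫ t in (-T)..T, 1 / (s - t * Complex.I)
        * ∑' n, c n * weightedCharFun Pr (W n) (X n) t) atTop
      (𝓝 (∑' n, c n * ∫ ω, {ω | 0 < X n ω}.indicator
        (fun ω => 2 * Real.pi * (W n ω * Complex.exp (-s * X n ω))) ω ∂Pr)) := by
  obtain ⟨M, hM⟩ := cauchyKernel_uniformly_bounded hs
  obtain ⟨d, hd, h⟩ := exists_norm_sub_mul_I_lower hs
  have hsum : ∀ T : ℝ, ∫ t in (-T)..T, 1 / (s - t * Complex.I)
        * ∑' n, c n * weightedCharFun Pr (W n) (X n) t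
      = ∑' n, c n * ∫ ω, W n ω * cauchyKernel s T (X n ω) ∂Pr := by
    intro T
    simp_rw [← integral_weightedCharFun hs (hW _) (hX _) (hW1 _) T,
      ← intervalIntegral.integral_const_mul]
    symm
    have hb : ∀ n (t : ℝ), ‖c n * (1 / (s - t * Complex.I) * weightedCharFun Pr (W n) (X n) t)‖
        ≤ ‖c n‖ * (1 / d) := by
      intro n t
      rw [norm_mul, norm_mul]
      have h1 : ‖1 / (s - t * Complex.I)‖ ≤ 1 / d :=
        (norm_one_div_sub_mul_I_le hd h t).trans
          (one_div_le_one_div_of_le hd (by nlinarith [abs_nonneg t]))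
      have h2 := norm_weightedCharFun_le (X := X n) (hW1 n) t
      calc _ ≤ ‖c n‖ * (1 / d * 1) := by gcongr
        _ = _ := by rw [mul_one]
    refine (intervalIntegral.hasSum_integral_of_dominated_convergence
      (fun n _ => ‖c n‖ * (1 / d)) (fun n => ?_) (fun n => Eventually.of_forall fun t _ => hb n t)
      (Eventually.of_forall fun t _ => hc.mul_right _) ?_
      (Eventually.of_forall fun t _ => ?_)).tsum_eq
    · exact (continuous_const.mul ((continuous_one_div_sub_mul_I hs).mul
        (continuous_weightedCharFun (hW n) (hX n) (hW1 n)))).aestronglyMeasurable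
    · exact _root_.intervalIntegrable_const
    · simp_rw [← tsum_mul_left, mul_left_comm _ (c _)]
      exact (Summable.of_norm_bounded (hc.mul_right (1 / d)) fun n => hb n t).hasSum
  simp_rw [hsum]
  refine tendsto_tsum_of_dominated_convergence (bound := fun n => ‖c n‖ * M) (hc.mul_right M)
    (fun n => ?_) ?_
  · rcases eq_or_ne (c n) 0 with h0 | h0
    · simp [h0]
    · exact (tendsto_integral_mul_cauchyKernel hs (hW n) (hX n) (hW1 n) (hX0 n h0)).const_mul _
  · filter_upwards [eventually_ge_atTop 0] with T hT n
    rw [norm_mul]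
    gcongr
    exact norm_integral_mul_cauchyKernel_le hM (hW1 n) hT

/-- Nonvanishing of `X n` is required only where `c n ≠ 0`: in the applications the walk sits at 0
at time n = 0, but the coefficient z^0/0 is zero by convention. -/
theorem hasPVIntegral_of_eq_tsum {s : ℂ} (hs : 0 < s.re)
    (hc : Summable fun n => ‖c n‖)
    (hW : ∀ n, Measurable (W n)) (hX : ∀ n, Measurable (X n))
    (hW1 : ∀ n, ∀ᵐ ω ∂Pr, ‖W n ω‖ ≤ 1) (hX0 : ∀ n, c n ≠ 0 → ∀ᵐ ω ∂Pr, X n ω ≠ 0)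
    {Ψ : ℂ → ℂ}
    (hΨ : ∀ t : ℝ, Ψ (t * Complex.I) = ∑' n, c n * weightedCharFun Pr (W n) (X n) t) :
    HasPVIntegral (fun ξ => 1 / (s - ξ) * Ψ ξ)
      (2 * Real.pi * Complex.I * ∑' n, c n * ∫ ω, {ω | 0 < X n ω}.indicator
        (fun ω => W n ω * Complex.exp (-s * X n ω)) ω ∂Pr) := by
  constructor
  · intro T
    simp only [hΨ]
    exact (((continuous_one_div_sub_mul_I hs).mul
      (continuous_tsum_weightedCharFun hc hW hX hW1)).mul continuous_const).intervalIntegrable _ _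
  · have := (tendsto_integral_tsum_weightedCharFun hs hc hW hX hW1 hX0).mul_const Complex.I
    simp only [hΨ, intervalIntegral.integral_mul_const]
    convert this using 2
    have e : ∀ n, ∫ ω, {ω | 0 < X n ω}.indicator
        (fun ω => 2 * Real.pi * (W n ω * Complex.exp (-s * X n ω))) ω ∂Pr
        = 2 * Real.pi * ∫ ω, {ω | 0 < X n ω}.indicator
        (fun ω => W n ω * Complex.exp (-s * X n ω)) ω ∂Pr := by
      intro n
      rw [← integral_const_mul]
      refine integral_congr_ae (Eventually.of_forall fun ω => ?_)
      simp only [Set.indicator]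
      split_ifs <;> simp
    simp_rw [e, mul_left_comm (c _), tsum_mul_left]
    ring

end Series

theorem HasPVIntegral.comp_neg {F : ℂ → ℂ} {L : ℂ} (h : HasPVIntegral (fun ξ => F (-ξ)) L) :
    HasPVIntegral F L := by
  constructor
  · intro T
    have h1 := ((IntervalIntegrable.iff_comp_neg (by finiteness)).1 (h.1 T)).symm
    simpa using h1
  · refine h.2.congr fun T => ?_
    have := intervalIntegral.integral_comp_neg (a := -T) (b := T)
      fun t : ℝ => F (t * Complex.I) * Complex.I
    rw [neg_neg] at this
    rw [← this]
    simp

theorem HasPVIntegral.sub {F G : ℂ → ℂ} {L M : ℂ} (hF : HasPVIntegral F L)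
    (hG : HasPVIntegral G M) : HasPVIntegral (fun ξ => F ξ - G ξ) (L - M) := by
  simp only [HasPVIntegral, sub_mul]
  refine ⟨fun T => (hF.1 T).sub (hG.1 T), (hF.2.sub hG.2).congr fun T => ?_⟩
  rw [intervalIntegral.integral_sub (hF.1 T) (hG.1 T)]

/-! ### The walk in the plane and its first exit from the half plane. -/

section Walk

variable {Ω : Type*}

/-- The walk in the plane with steps `(B i, A i)`. -/
def planeWalk (B A : ℕ → Ω → ℝ) (n : ℕ) (ω : Ω) : ℝ × ℝ :=
  ∑ i ∈ Finset.range n, (B i ω, A i ω)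

theorem planeWalk_fst (B A : ℕ → Ω → ℝ) (n : ℕ) (ω : Ω) :
    (planeWalk B A n ω).1 = partialSum B n ω := by
  simp [planeWalk, partialSum, Prod.fst_sum]

theorem walk_eq_planeWalk (B A : ℕ → Ω → ℝ) (n : ℕ) (ω : Ω) :
    walk B A n ω = (planeWalk B A n ω).1 - (planeWalk B A n ω).2 := by
  simp [planeWalk, walk, partialSum, Prod.fst_sum, Prod.snd_sum]

theorem planeWalk_succ (B A : ℕ → Ω → ℝ) (n : ℕ) (ω : Ω) :
    planeWalk B A (n + 1) ω = planeWalk B A n ω + (B n ω, A n ω) :=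
  Finset.sum_range_succ _ _

/-- The half plane in which the walk is nonnegative. -/
def upperHalf : Set (ℝ × ℝ) := {p | 0 ≤ p.1 - p.2}

theorem measurableSet_upperHalf : MeasurableSet upperHalf :=
  measurableSet_le measurable_const (by fun_prop)

theorem mem_compl_upperHalf {p : ℝ × ℝ} : p ∈ upperHalfᶜ ↔ p.1 < p.2 := by
  simp [upperHalf]

/-- The event that the walk is nonnegative up to time `n`. -/
def survives (B A : ℕ → Ω → ℝ) (n : ℕ) : Set Ω := {ω | ∀ j ≤ n, planeWalk B A j ω ∈ upperHalf}

/-- The event that the walk is negative for the first time at time `n + 1`. -/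
def exitsAt (B A : ℕ → Ω → ℝ) (n : ℕ) : Set Ω :=
  survives B A n ∩ planeWalk B A (n + 1) ⁻¹' upperHalfᶜ

theorem survives_zero (B A : ℕ → Ω → ℝ) : survives B A 0 = Set.univ := by
  ext ω; simp [survives, planeWalk, upperHalf]

theorem survives_succ (B A : ℕ → Ω → ℝ) (n : ℕ) :
    survives B A (n + 1) = survives B A n ∩ planeWalk B A (n + 1) ⁻¹' upperHalf := by
  ext ω
  simp only [survives, Set.mem_ofPred_eq, Set.mem_inter_iff, Set.mem_preimage]
  refine ⟨fun h => ⟨fun j hj => h j (by omega), h _ le_rfl⟩, fun h j hj => ?_⟩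
  rcases Nat.le_succ_iff.1 hj with hj | rfl
  exacts [h.1 j hj, h.2]

theorem walk_mem_Iio_iff (B A : ℕ → Ω → ℝ) (n : ℕ) (ω : Ω) :
    walk B A n ω ∈ Set.Iio 0 ↔ planeWalk B A n ω ∉ upperHalf := by
  simp [walk_eq_planeWalk, upperHalf]

theorem ladderTime_eq_of_mem_exitsAt {B A : ℕ → Ω → ℝ} {n : ℕ} {ω : Ω} (h : ω ∈ exitsAt B A n) :
    ladderTime B A ω = ((n + 1 : ℕ) : WithTop ℕ) := by
  refine le_antisymm (hittingAfter_le_of_mem zero_le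
    ((walk_mem_Iio_iff B A _ ω).2 h.2)) (not_lt.1 fun hlt => ?_)
  obtain ⟨j, hj, hj'⟩ := hittingAfter_lt_iff.1 hlt
  exact (walk_mem_Iio_iff B A _ ω).1 hj' (h.1 j (Nat.lt_succ_iff.1 hj.2))

theorem setOf_ladderTime_ne_top (B A : ℕ → Ω → ℝ) :
    {ω | ladderTime B A ω ≠ ⊤} = ⋃ n, exitsAt B A n := by
  ext ω
  simp only [Set.mem_ofPred_eq, Set.mem_iUnion]
  constructor
  · intro h
    have hex : ∃ j, planeWalk B A j ω ∉ upperHalf := by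
      rw [ladderTime, ne_eq, hittingAfter_eq_top_iff] at h
      push Not at h
      obtain ⟨j, -, hj⟩ := h
      exact ⟨j, (walk_mem_Iio_iff B A _ ω).1 hj⟩
    classical
    obtain ⟨m, hm⟩ : ∃ m, Nat.find hex = m + 1 := by
      refine Nat.exists_eq_succ_of_ne_zero fun h0 => ?_
      have := Nat.find_spec hex
      rw [h0] at this
      simp [planeWalk, upperHalf] at this
    refine ⟨m, fun j hj => not_not.1 (Nat.find_min hex (by omega)), ?_⟩
    have := Nat.find_spec hex
    rwa [hm] at this
  · rintro ⟨n, hn⟩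
    rw [ladderTime_eq_of_mem_exitsAt hn]
    exact WithTop.coe_ne_top

theorem pairwise_disjoint_exitsAt (B A : ℕ → Ω → ℝ) :
    Pairwise (Function.onFun Disjoint (exitsAt B A)) := by
  intro m n hmn
  refine Set.disjoint_left.2 fun ω hm hn => hmn ?_
  have := (ladderTime_eq_of_mem_exitsAt hm).symm.trans (ladderTime_eq_of_mem_exitsAt hn)
  exact Nat.succ_injective (WithTop.coe_injective this)

theorem stoppedValue_of_mem_exitsAt {B A : ℕ → Ω → ℝ} {n : ℕ} {ω : Ω} (h : ω ∈ exitsAt B A n)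
    {E : Type*} (u : ℕ → Ω → E) : stoppedValue u (ladderTime B A) ω = u (n + 1) ω := by
  rw [stoppedValue, ladderTime_eq_of_mem_exitsAt h]
  rfl

end Walk

/-! ### Laws of the walk: independent steps as convolution. -/

section Law

variable {Ω : Type*} [MeasurableSpace Ω]

theorem measurable_planeWalk {B A : ℕ → Ω → ℝ} (hB : ∀ n, Measurable (B n))
    (hA : ∀ n, Measurable (A n)) (n : ℕ) : Measurable (planeWalk B A n) :=
  Finset.measurable_fun_sum _ fun i _ => (hB i).prodMk (hA i)

theorem measurableSet_survives {B A : ℕ → Ω → ℝ} (n : ℕ)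
    (h : ∀ j ≤ n, Measurable (planeWalk B A j)) : MeasurableSet (survives B A n) := by
  have : survives B A n = ⋂ j, ⋂ (_ : j ≤ n), planeWalk B A j ⁻¹' upperHalf := by
    ext; simp [survives]
  rw [this]
  exact MeasurableSet.iInter fun j => MeasurableSet.iInter fun hj => h j hj measurableSet_upperHalf

theorem measurableSet_exitsAt {B A : ℕ → Ω → ℝ} (hB : ∀ n, Measurable (B n))
    (hA : ∀ n, Measurable (A n)) (n : ℕ) : MeasurableSet (exitsAt B A n) :=
  (measurableSet_survives n fun j _ => measurable_planeWalk hB hA j).inter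
    (measurable_planeWalk hB hA _ measurableSet_upperHalf.compl)

/-- For `D` in the past `F`, independence makes the joint law of (Z, ψ) restricted to `D` a product,
checked on rectangles. This is where the Markov step of the walk enters. -/
theorem map_restrict_add_eq_conv {Ω : Type*} {F m0 : MeasurableSpace Ω} {G : Type*}
    [AddCommMonoid G] [MeasurableSpace G] [MeasurableAdd₂ G] {Pr : Measure Ω}
    [IsProbabilityMeasure Pr] (hF : F ≤ m0) {Z ψ : Ω → G}
    (hZ : Measurable[F] Z) (hψ : Measurable ψ)
    (hind : Indep F (MeasurableSpace.comap ψ inferInstance) Pr) {D : Set Ω}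
    (hD : MeasurableSet[F] D) :
    (Pr.restrict D).map (fun ω => Z ω + ψ ω) = ((Pr.restrict D).map Z) ∗ (Pr.map ψ) := by
  have hZ' : Measurable Z := hZ.mono hF le_rfl
  have : IsProbabilityMeasure (Pr.map ψ) := Measure.isProbabilityMeasure_map hψ.aemeasurable
  have key : ((Pr.restrict D).map Z).prod (Pr.map ψ)
      = (Pr.restrict D).map (fun ω => (Z ω, ψ ω)) := by
    refine Measure.prod_eq fun s t hs ht => ?_
    rw [Measure.map_apply (hZ'.prodMk hψ) (hs.prod ht), Measure.map_apply hZ' hs,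
      Measure.map_apply hψ ht, Measure.restrict_apply (hZ' hs),
      Measure.restrict_apply ((hZ'.prodMk hψ) (hs.prod ht)),
      ← (Indep_iff _ _ _).1 hind _ _ ((hZ hs).inter hD) ⟨t, ht, rfl⟩]
    congr 1
    ext ω
    simp only [Set.mem_inter_iff, Set.mem_preimage, Set.mem_prod]
    tauto
  rw [Measure.conv, key, Measure.map_map (by fun_prop) (hZ'.prodMk hψ)]
  rfl

theorem map_restrict_survives_succ_of_indep {Ω : Type*} {F m0 : MeasurableSpace Ω}
    {Pr : Measure Ω} [IsProbabilityMeasure Pr] {B A : ℕ → Ω → ℝ} (hF : F ≤ m0) (n : ℕ)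
    (hψF : ∀ i < n, Measurable[F] fun ω => (B i ω, A i ω))
    (hψ : Measurable fun ω => (B n ω, A n ω))
    (hind : Indep F (MeasurableSpace.comap (fun ω => (B n ω, A n ω)) inferInstance) Pr) :
    (Pr.restrict (survives B A n)).map (planeWalk B A (n + 1))
        = ((Pr.restrict (survives B A n)).map (planeWalk B A n))
          ∗ Pr.map (fun ω => (B n ω, A n ω)) ∧
      Pr.map (planeWalk B A (n + 1))
        = (Pr.map (planeWalk B A n)) ∗ Pr.map (fun ω => (B n ω, A n ω)) := by
  have hZ : ∀ j ≤ n, Measurable[F] (planeWalk B A j) := fun j hj =>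
    Finset.measurable_fun_sum _ fun i hi => hψF i ((Finset.mem_range.1 hi).trans_le hj)
  have hS : MeasurableSet[F] (survives B A n) :=
    @measurableSet_survives Ω F B A n hZ
  have e : planeWalk B A (n + 1) = fun ω => planeWalk B A n ω + (B n ω, A n ω) :=
    funext fun ω => planeWalk_succ B A n ω
  rw [e]
  refine ⟨map_restrict_add_eq_conv hF (hZ n le_rfl) hψ hind hS, ?_⟩
  simpa using map_restrict_add_eq_conv hF (hZ n le_rfl) hψ hind
    (@MeasurableSet.univ Ω F)

theorem map_restrict_survives_succ {Pr : Measure Ω} [IsProbabilityMeasure Pr]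
    {μ : Measure (ℝ × ℝ)} {B A : ℕ → Ω → ℝ} (hB : ∀ n, Measurable (B n))
    (hA : ∀ n, Measurable (A n)) (hindep : iIndepFun (fun n ω => (B n ω, A n ω)) Pr)
    (hlaw : ∀ n, Pr.map (fun ω => (B n ω, A n ω)) = μ) (n : ℕ) :
    (Pr.restrict (survives B A n)).map (planeWalk B A (n + 1))
        = ((Pr.restrict (survives B A n)).map (planeWalk B A n)) ∗ μ ∧
      Pr.map (planeWalk B A (n + 1)) = (Pr.map (planeWalk B A n)) ∗ μ := by
  have hψ : ∀ n, Measurable fun ω => (B n ω, A n ω) := fun n => (hB n).prodMk (hA n)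
  rw [← hlaw n]
  -- The past is generated by the steps with index below n; step n is independent of it.
  refine map_restrict_survives_succ_of_indep (F := ⨆ i ∈ Set.Iio n,
    MeasurableSpace.comap (fun ω => (B i ω, A i ω)) inferInstance)
    (iSup₂_le fun i _ => (hψ i).comap_le) n (fun i hi => ?_) (hψ n) ?_
  · exact Measurable.mono (comap_measurable _)
      (le_iSup₂_of_le (f := fun i (_ : i ∈ Set.Iio n) =>
        MeasurableSpace.comap (fun ω => (B i ω, A i ω)) inferInstance) i hi le_rfl) le_rfl
  · have := indep_iSup_of_disjoint (fun i => (hψ i).comap_le) hindep.iIndep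
      (S := Set.Iio n) (T := {n}) (by simp)
    simpa using this

theorem map_planeWalk_eq_pow {Pr : Measure Ω} [IsProbabilityMeasure Pr]
    {μ : FiniteMeasure (ℝ × ℝ)} {B A : ℕ → Ω → ℝ} (hB : ∀ n, Measurable (B n))
    (hA : ∀ n, Measurable (A n)) (hindep : iIndepFun (fun n ω => (B n ω, A n ω)) Pr)
    (hlaw : ∀ n, Pr.map (fun ω => (B n ω, A n ω)) = μ) (n : ℕ) :
    Pr.map (planeWalk B A n) = (μ ^ n : FiniteMeasure (ℝ × ℝ)) := by
  induction n with
  | zero =>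
    rw [pow_zero, toMeasure_one, show planeWalk B A 0 = fun _ => 0 from rfl, Measure.map_const]
    simp
  | succ n ih =>
    rw [(map_restrict_survives_succ hB hA hindep hlaw n).2, pow_succ, toMeasure_mul, ih]

theorem integral_pow_of_map_add {G : Type*} [AddCommMonoid G] [MeasurableSpace G]
    [MeasurableAdd₂ G] (μ : FiniteMeasure G) {χ : G → ℂ}
    (hχ : Measurable χ) (hmul : ∀ x y, χ (x + y) = χ x * χ y) (h0 : χ 0 = 1) (n : ℕ) :
    ∫ x, χ x ∂((μ ^ n : FiniteMeasure G) : Measure G) = (∫ x, χ x ∂(μ : Measure G)) ^ n := by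
  induction n with
  | zero =>
    rw [pow_zero, pow_zero, toMeasure_one, integral_dirac' _ _ hχ.stronglyMeasurable, h0]
  | succ n ih => rw [pow_succ, pow_succ, toMeasure_mul, integral_conv_of_map_add hχ hmul, ih]

theorem ae_planeWalk_nonneg {Pr : Measure Ω} {μ : Measure (ℝ × ℝ)} {B A : ℕ → Ω → ℝ}
    (hB : ∀ n, Measurable (B n)) (hA : ∀ n, Measurable (A n))
    (hlaw : ∀ n, Pr.map (fun ω => (B n ω, A n ω)) = μ) (hquad : ∀ᵐ p ∂μ, 0 ≤ p.1 ∧ 0 ≤ p.2) :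
    ∀ᵐ ω ∂Pr, ∀ n, 0 ≤ (planeWalk B A n ω).1 ∧ 0 ≤ (planeWalk B A n ω).2 := by
  have h : ∀ᵐ ω ∂Pr, ∀ i, 0 ≤ B i ω ∧ 0 ≤ A i ω := by
    rw [ae_all_iff]
    intro i
    rw [← hlaw i] at hquad
    exact ae_of_ae_map ((hB i).prodMk (hA i)).aemeasurable hquad
  filter_upwards [h] with ω hω n
  simp only [planeWalk, Prod.fst_sum, Prod.snd_sum]
  exact ⟨Finset.sum_nonneg fun i _ => (hω i).1, Finset.sum_nonneg fun i _ => (hω i).2⟩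

end Law

/-! ### Spitzer's identity for the walk and the expansion of the logarithm. -/

section Spitzer

variable {Ω : Type*} [MeasurableSpace Ω] {Pr : Measure Ω} [IsProbabilityMeasure Pr]
  {μ : FiniteMeasure (ℝ × ℝ)} {B A : ℕ → Ω → ℝ}

/-- The laws of the walk on the events of survival up to time `n`. -/
noncomputable def survivalLaw (Pr : Measure Ω) [IsProbabilityMeasure Pr] (B A : ℕ → Ω → ℝ) (n : ℕ) :
    FiniteMeasure (ℝ × ℝ) :=
  ⟨(Pr.restrict (survives B A n)).map (planeWalk B A n), inferInstance⟩

/-- The laws of the walk on the events of a first exit at time `n`. -/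
noncomputable def exitLaw (Pr : Measure Ω) [IsProbabilityMeasure Pr] (B A : ℕ → Ω → ℝ) :
    ℕ → FiniteMeasure (ℝ × ℝ)
  | 0 => 0
  | n + 1 => ⟨(Pr.restrict (exitsAt B A n)).map (planeWalk B A (n + 1)), inferInstance⟩

theorem survivalLaw_zero : survivalLaw Pr B A 0 = 1 := by
  refine Subtype.ext ?_
  change (Pr.restrict (survives B A 0)).map (fun _ => 0) = Measure.dirac 0
  rw [survives_zero, Measure.restrict_univ, Measure.map_const]
  simp

theorem survivalLaw_succ (hB : ∀ n, Measurable (B n))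
    (hA : ∀ n, Measurable (A n)) (hindep : iIndepFun (fun n ω => (B n ω, A n ω)) Pr)
    (hlaw : ∀ n, Pr.map (fun ω => (B n ω, A n ω)) = μ) (n : ℕ) :
    survivalLaw Pr B A (n + 1) = restrictHom upperHalf (survivalLaw Pr B A n * μ) := by
  refine Subtype.ext ?_
  change (Pr.restrict (survives B A (n + 1))).map (planeWalk B A (n + 1))
    = (((Pr.restrict (survives B A n)).map (planeWalk B A n)) ∗ (μ : Measure (ℝ × ℝ))).restrict
      upperHalf
  have hm := measurable_planeWalk hB hA (n + 1)
  rw [← (map_restrict_survives_succ hB hA hindep hlaw n).1,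
    Measure.restrict_map hm measurableSet_upperHalf,
    Measure.restrict_restrict (hm measurableSet_upperHalf), survives_succ, Set.inter_comm]

theorem exitLaw_succ (hB : ∀ n, Measurable (B n))
    (hA : ∀ n, Measurable (A n)) (hindep : iIndepFun (fun n ω => (B n ω, A n ω)) Pr)
    (hlaw : ∀ n, Pr.map (fun ω => (B n ω, A n ω)) = μ) (n : ℕ) :
    exitLaw Pr B A (n + 1) = restrictHom upperHalfᶜ (survivalLaw Pr B A n * μ) := by
  refine Subtype.ext ?_
  change (Pr.restrict (exitsAt B A n)).map (planeWalk B A (n + 1))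
    = (((Pr.restrict (survives B A n)).map (planeWalk B A n)) ∗ (μ : Measure (ℝ × ℝ))).restrict
      upperHalfᶜ
  have hm := measurable_planeWalk hB hA (n + 1)
  rw [← (map_restrict_survives_succ hB hA hindep hlaw n).1,
    Measure.restrict_map hm measurableSet_upperHalf.compl,
    Measure.restrict_restrict (hm measurableSet_upperHalf.compl), exitsAt, Set.inter_comm]

/-- The Spitzer-Baxter identity for the walk, on the level of transforms. -/
theorem one_sub_tsum_integral_exitsAt (hB : ∀ n, Measurable (B n))
    (hA : ∀ n, Measurable (A n)) (hindep : iIndepFun (fun n ω => (B n ω, A n ω)) Pr)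
    (hlaw : ∀ n, Pr.map (fun ω => (B n ω, A n ω)) = μ)
    {χ : ℝ × ℝ → ℂ} (hχ : Measurable χ) (hmul : ∀ x y, χ (x + y) = χ x * χ y)
    (hbd : ∀ᵐ ω ∂Pr, ∀ n, planeWalk B A n ω ∉ upperHalf → ‖χ (planeWalk B A n ω)‖ ≤ 1)
    {z : ℂ} (hz : ‖z‖ < 1) :
    1 - ∑' n, (∫ ω in exitsAt B A n, χ (planeWalk B A (n + 1) ω) ∂Pr) * z ^ (n + 1)
      = Complex.exp (-∑' n, (∫ ω in planeWalk B A n ⁻¹' upperHalfᶜ, χ (planeWalk B A n ω) ∂Pr)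
          * z ^ n / n) := by
  have hm := measurable_planeWalk hB hA
  have hmS : ∀ n, MeasurableSet (planeWalk B A n ⁻¹' upperHalfᶜ) := fun n =>
    hm n measurableSet_upperHalf.compl
  have hχm : MeasurableSet {p | ‖χ p‖ ≤ 1} := measurableSet_le hχ.norm measurable_const
  -- χ is bounded only where the walk is negative, since e^{-s(a-b)} may grow on the other half
  -- plane. This suffices because the recurrence for `V` involves no survival law.
  have hbdA : ∀ n, ∀ᵐ ω ∂(Pr.restrict (planeWalk B A n ⁻¹' upperHalfᶜ)),
      ‖χ (planeWalk B A n ω)‖ ≤ 1 := fun n => by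
    filter_upwards [ae_restrict_of_ae hbd, ae_restrict_mem (hmS n)] with ω h1 h2 using h1 n h2
  have hbdV : ∀ n, ∀ᵐ ω ∂(Pr.restrict (exitsAt B A n)), ‖χ (planeWalk B A (n + 1) ω)‖ ≤ 1 :=
    fun n => ae_restrict_of_ae_restrict_of_subset Set.inter_subset_right (hbdA (n + 1))
  have eA : ∀ n, (restrictHom upperHalfᶜ (μ ^ n) : Measure (ℝ × ℝ))
      = (Pr.restrict (planeWalk B A n ⁻¹' upperHalfᶜ)).map (planeWalk B A n) := fun n => by
    rw [toMeasure_restrictHom, ← map_planeWalk_eq_pow hB hA hindep hlaw,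
      Measure.restrict_map (hm n) measurableSet_upperHalf.compl]
  have eV : ∀ n, (exitLaw Pr B A (n + 1) : Measure (ℝ × ℝ))
      = (Pr.restrict (exitsAt B A n)).map (planeWalk B A (n + 1)) := fun n => rfl
  have eV0 : (exitLaw Pr B A 0 : Measure (ℝ × ℝ)) = 0 := rfl
  have iA : ∀ n, ∫ p, χ p ∂(restrictHom upperHalfᶜ (μ ^ n) : Measure (ℝ × ℝ))
      = ∫ ω in planeWalk B A n ⁻¹' upperHalfᶜ, χ (planeWalk B A n ω) ∂Pr := fun n => by
    rw [eA, integral_map (hm n).aemeasurable hχ.aestronglyMeasurable]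
  have iV : ∀ n, ∫ p, χ p ∂(exitLaw Pr B A (n + 1) : Measure (ℝ × ℝ))
      = ∫ ω in exitsAt B A n, χ (planeWalk B A (n + 1) ω) ∂Pr := fun n => by
    rw [eV, integral_map (hm _).aemeasurable hχ.aestronglyMeasurable]
  have bound : ∀ (D : Set Ω) (f : Ω → ℂ), (∀ᵐ ω ∂(Pr.restrict D), ‖f ω‖ ≤ 1) →
      ‖∫ ω in D, f ω ∂Pr‖ ≤ 1 := fun D f hf => by
    refine (norm_integral_le_of_norm_le_const hf).trans ?_
    rw [one_mul, measureReal_restrict_apply_univ]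
    exact measureReal_le_one
  have nA : ∀ n, ‖∫ p, χ p ∂(restrictHom upperHalfᶜ (μ ^ n) : Measure (ℝ × ℝ))‖ ≤ 1 := fun n => by
    rw [iA]; exact bound _ _ (hbdA n)
  have nV : ∀ n, ‖∫ p, χ p ∂(exitLaw Pr B A n : Measure (ℝ × ℝ))‖ ≤ 1 := by
    rintro (_ | n)
    · simp [eV0]
    · rw [iV]; exact bound _ _ (hbdV n)
  have key := one_sub_tsum_eq_exp nV nA (by simp [eV0]) (integral_spitzer_recurrence
    measurableSet_upperHalf ?_ ?_ (by simp [upperHalf]) μ (survivalLaw Pr B A) (exitLaw Pr B A)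
    survivalLaw_zero rfl (survivalLaw_succ hB hA hindep hlaw) (exitLaw_succ hB hA hindep hlaw)
    hχ hmul ?_ ?_) hz
  · simp_rw [iA] at key
    have hsum : Summable fun n =>
        (∫ p, χ p ∂(exitLaw Pr B A n : Measure (ℝ × ℝ))) * z ^ n := by
      refine Summable.of_norm_bounded (summable_geometric_of_lt_one (norm_nonneg z) hz) fun n => ?_
      rw [norm_mul, norm_pow]
      exact mul_le_of_le_one_left (pow_nonneg (norm_nonneg z) n) (nV n)
    rw [← key, hsum.tsum_eq_zero_add]
    simp [eV0, iV]
  · intro x hx y hy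
    simp only [upperHalf, Set.mem_ofPred_eq, Prod.fst_add, Prod.snd_add] at *
    linarith
  · intro x hx y hy
    simp only [mem_compl_upperHalf, Prod.fst_add, Prod.snd_add] at *
    linarith
  · intro n
    rw [eA]
    exact Integrable.of_bound hχ.aestronglyMeasurable 1
      ((ae_map_iff (hm n).aemeasurable hχm).2 (hbdA n))
  · rintro (_ | n)
    · rw [eV0]; exact integrable_zero_measure
    · rw [eV]
      exact Integrable.of_bound hχ.aestronglyMeasurable 1
        ((ae_map_iff (hm _).aemeasurable hχm).2 (hbdV n))

/-- The additive functional `y` is a - b for the idle period and b for the busy period. The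
expectation splits over the disjoint events N = n + 1, on which `Y` is a function of the position.
-/
theorem integrable_discounted_and_integral_eq (hB : ∀ n, Measurable (B n))
    (hA : ∀ n, Measurable (A n)) (hindep : iIndepFun (fun n ω => (B n ω, A n ω)) Pr)
    (hlaw : ∀ n, Pr.map (fun ω => (B n ω, A n ω)) = μ)
    {y : ℝ × ℝ → ℝ} (hy : Measurable y) (hadd : ∀ p q, y (p + q) = y p + y q)
    (hpos : ∀ᵐ ω ∂Pr, ∀ n, planeWalk B A n ω ∉ upperHalf → 0 ≤ y (planeWalk B A n ω))
    {Y : Ω → ℝ} (hY : ∀ n, ∀ ω ∈ exitsAt B A n, Y ω = y (planeWalk B A (n + 1) ω))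
    {s z : ℂ} (hs : 0 < s.re) (hz : ‖z‖ < 1) :
    Integrable (discounted (ladderTime B A) Y z s) Pr ∧
      ∫ ω, discounted (ladderTime B A) Y z s ω ∂Pr
        = 1 - Complex.exp (∑' n : ℕ, -(z ^ n / n) *
          ∫ ω in planeWalk B A n ⁻¹' upperHalfᶜ, Complex.exp (-s * y (planeWalk B A n ω)) ∂Pr) := by
  set χ : ℝ × ℝ → ℂ := fun p => Complex.exp (-s * y p)
  have hχ : Measurable χ := by fun_prop
  have hbd : ∀ᵐ ω ∂Pr, ∀ n, planeWalk B A n ω ∉ upperHalf → ‖χ (planeWalk B A n ω)‖ ≤ 1 := by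
    filter_upwards [hpos] with ω hω n hn
    simp only [χ]
    rw [Complex.norm_exp, Real.exp_le_one_iff]
    have := hω n hn
    simp
    positivity
  have hm := measurable_planeWalk hB hA
  have hE := measurableSet_exitsAt hB hA
  have hval : ∀ n, ∀ ω ∈ exitsAt B A n, z ^ (ladderTime B A ω).untopA * Complex.exp (-s * (Y ω : ℂ))
      = χ (planeWalk B A (n + 1) ω) * z ^ (n + 1) := by
    intro n ω hω
    rw [ladderTime_eq_of_mem_exitsAt hω, hY n ω hω, mul_comm]
    rfl
  have hU : MeasurableSet (⋃ n, exitsAt B A n) := MeasurableSet.iUnion hE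
  have hint : IntegrableOn (fun ω => z ^ (ladderTime B A ω).untopA * Complex.exp (-s * (Y ω : ℂ)))
      (⋃ n, exitsAt B A n) Pr := by
    refine Integrable.of_bound (C := 1) ?_ ?_
    · refine aestronglyMeasurable_iUnion_iff.2 fun n => ?_
      refine AEStronglyMeasurable.congr
        (f := fun ω => χ (planeWalk B A (n + 1) ω) * z ^ (n + 1)) ?_ ?_
      · exact ((hχ.comp (hm _)).mul_const _).aestronglyMeasurable
      · filter_upwards [ae_restrict_mem (hE n)] with ω hω using (hval n ω hω).symm
    · filter_upwards [ae_restrict_of_ae hbd, ae_restrict_mem hU] with ω h1 h2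
      obtain ⟨n, hn⟩ := Set.mem_iUnion.1 h2
      rw [hval n ω hn, norm_mul, norm_pow]
      exact mul_le_one₀ (h1 _ hn.2) (by positivity) (pow_le_one₀ (norm_nonneg _) hz.le)
  have hdisc : discounted (ladderTime B A) Y z s = (⋃ n, exitsAt B A n).indicator
      (fun ω => z ^ (ladderTime B A ω).untopA * Complex.exp (-s * (Y ω : ℂ))) := by
    rw [discounted, setOf_ladderTime_ne_top]
  rw [hdisc]
  refine ⟨(integrable_indicator_iff hU).2 hint, ?_⟩
  have key := one_sub_tsum_integral_exitsAt hB hA hindep hlaw hχ (fun p q => ?_) hbd hz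
  · rw [integral_indicator hU, integral_iUnion hE (pairwise_disjoint_exitsAt B A) hint]
    have e : ∀ n, ∫ ω in exitsAt B A n,
        z ^ (ladderTime B A ω).untopA * Complex.exp (-s * (Y ω : ℂ)) ∂Pr
        = (∫ ω in exitsAt B A n, χ (planeWalk B A (n + 1) ω) ∂Pr) * z ^ (n + 1) := fun n => by
      rw [← integral_mul_const]
      exact setIntegral_congr_fun (hE n) (hval n)
    simp_rw [e]
    rw [← tsum_neg] at key
    rw [eq_sub_iff_add_eq, ← eq_sub_iff_add_eq', key]
    congr 2
    ext n
    ring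
  · simp only [χ]
    rw [← Complex.exp_add, hadd]
    push_cast; ring_nf

/-- Since ‖z h‖ < 1, the principal logarithm is its Taylor series, and h^n is the transform of the
n-step walk. The term n = 0 drops out through division by zero. -/
theorem log_one_sub_eq_tsum (hB : ∀ n, Measurable (B n))
    (hA : ∀ n, Measurable (A n)) (hindep : iIndepFun (fun n ω => (B n ω, A n ω)) Pr)
    (hlaw : ∀ n, Pr.map (fun ω => (B n ω, A n ω)) = μ)
    (hquad : ∀ᵐ p ∂(μ : Measure (ℝ × ℝ)), 0 ≤ p.1 ∧ 0 ≤ p.2) {s₁ s₂ : ℂ}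
    (hs₁ : 0 ≤ s₁.re) (hs₂ : 0 ≤ s₂.re) {z : ℂ} (hz : ‖z‖ < 1) :
    Complex.log (1 - z * jointLST μ s₁ s₂) = ∑' n : ℕ, -(z ^ n / n) *
      ∫ ω, Complex.exp (-s₁ * (planeWalk B A n ω).1 - s₂ * (planeWalk B A n ω).2) ∂Pr := by
  set χ : ℝ × ℝ → ℂ := fun p => Complex.exp (-s₁ * p.1 - s₂ * p.2)
  have hχ : Measurable χ := by fun_prop
  have hμ : IsProbabilityMeasure (μ : Measure (ℝ × ℝ)) := by
    rw [← hlaw 0]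
    exact Measure.isProbabilityMeasure_map ((hB 0).prodMk (hA 0)).aemeasurable
  have hnorm : ‖jointLST μ s₁ s₂‖ ≤ 1 := by
    have := norm_integral_le_of_norm_le_const (μ := (μ : Measure (ℝ × ℝ))) (f := χ) (C := 1) ?_
    · rw [probReal_univ, mul_one] at this
      exact this
    filter_upwards [hquad] with p hp
    simp only [χ]
    rw [Complex.norm_exp, Real.exp_le_one_iff]
    have h1 := mul_nonneg hs₁ hp.1
    have h2 := mul_nonneg hs₂ hp.2
    simp
    linarith
  have hlt : ‖z * jointLST μ s₁ s₂‖ < 1 := by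
    rw [norm_mul]
    exact (mul_le_of_le_one_right (norm_nonneg _) hnorm).trans_lt hz
  have hpow : ∀ n, ∫ ω, χ (planeWalk B A n ω) ∂Pr = jointLST μ s₁ s₂ ^ n := fun n => by
    rw [← integral_map (measurable_planeWalk hB hA n).aemeasurable hχ.aestronglyMeasurable,
      map_planeWalk_eq_pow hB hA hindep hlaw, integral_pow_of_map_add μ hχ]
    · rfl
    · intro p q
      simp only [χ, Prod.fst_add, Prod.snd_add]
      rw [← Complex.exp_add]
      push_cast; ring_nf
    · simp [χ]
  have h := (Complex.hasSum_taylorSeries_neg_log hlt).neg.tsum_eq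
  rw [neg_neg] at h
  rw [← h]
  refine tsum_congr fun n => ?_
  rw [hpow, mul_pow]
  ring

end Spitzer

/-! ### Assembly of the two transforms. -/

section Transforms

theorem ae_planeWalk_fst_ne_zero {Ω : Type*} [MeasurableSpace Ω] {Pr : Measure Ω}
    {μ : FiniteMeasure (ℝ × ℝ)} {B A : ℕ → Ω → ℝ} (hB : ∀ n, Measurable (B n))
    (hA : ∀ n, Measurable (A n)) (hlaw : ∀ n, Pr.map (fun ω => (B n ω, A n ω)) = μ)
    (hquad : ∀ᵐ p ∂(μ : Measure (ℝ × ℝ)), 0 ≤ p.1 ∧ 0 ≤ p.2)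
    (h0 : (μ : Measure (ℝ × ℝ)) {p | p.1 = 0} = 0) {n : ℕ} (hn : n ≠ 0) :
    ∀ᵐ ω ∂Pr, (planeWalk B A n ω).1 ≠ 0 := by
  obtain ⟨m, rfl⟩ := Nat.exists_eq_succ_of_ne_zero hn
  have h1 : ∀ᵐ ω ∂Pr, B m ω ≠ 0 := by
    have : ∀ᵐ p ∂(μ : Measure (ℝ × ℝ)), p.1 ≠ 0 := by
      rw [ae_iff]; simpa using h0
    rw [← hlaw m] at this
    exact ae_of_ae_map ((hB m).prodMk (hA m)).aemeasurable this
  have h2 : ∀ᵐ ω ∂Pr, 0 ≤ B m ω := by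
    rw [← hlaw m] at hquad
    filter_upwards [ae_of_ae_map ((hB m).prodMk (hA m)).aemeasurable hquad] with ω h using h.1
  filter_upwards [h1, h2, ae_planeWalk_nonneg hB hA hlaw hquad] with ω h1 h2 h3
  rw [planeWalk_succ, Prod.fst_add]
  have := (h3 m).1
  have := lt_of_le_of_ne h2 h1.symm
  positivity

variable {Ω : Type*} [MeasurableSpace Ω] {Pr : Measure Ω} [IsProbabilityMeasure Pr]
  {μ : FiniteMeasure (ℝ × ℝ)} {B A : ℕ → Ω → ℝ}

theorem summable_norm_neg_pow_div {z : ℂ} (hz : ‖z‖ < 1) :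
    Summable fun n : ℕ => ‖-(z ^ n / n)‖ := by
  refine Summable.of_nonneg_of_le (fun _ => norm_nonneg _) (fun n => ?_)
    (summable_geometric_of_lt_one (norm_nonneg z) hz)
  rw [norm_neg, norm_div, norm_pow, Complex.norm_natCast]
  rcases Nat.eq_zero_or_pos n with rfl | hn
  · simp
  · exact div_le_self (by positivity) (by exact_mod_cast hn)

theorem ne_zero_of_neg_pow_div_ne_zero {z : ℂ} {n : ℕ} (h : -(z ^ n / n) ≠ 0) : n ≠ 0 := by
  rintro rfl
  simp at h

theorem one_div_two_pi_I_mul (x : ℂ) :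
    1 / (2 * Real.pi * Complex.I) * (2 * Real.pi * Complex.I * x) = x := by
  rw [one_div, inv_mul_cancel_left₀ Complex.two_pi_I_ne_zero]

/-- The transform of the idle period. -/
theorem idlePeriod_transform (hB : ∀ n, Measurable (B n))
    (hA : ∀ n, Measurable (A n)) (hindep : iIndepFun (fun n ω => (B n ω, A n ω)) Pr)
    (hlaw : ∀ n, Pr.map (fun ω => (B n ω, A n ω)) = μ)
    (hquad : ∀ᵐ p ∂(μ : Measure (ℝ × ℝ)), 0 ≤ p.1 ∧ 0 ≤ p.2)
    (htie : ∀ n : ℕ, n ≠ 0 → ∀ᵐ ω ∂Pr, (planeWalk B A n ω).1 - (planeWalk B A n ω).2 ≠ 0)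
    {s z : ℂ} (hs : 0 < s.re) (hz : ‖z‖ < 1) :
    Integrable (discounted (ladderTime B A) (idlePeriod B A) z s) Pr ∧
      ∃ L : ℂ,
        HasPVIntegral (fun ξ => 1 / (s + ξ) * Complex.log (1 - z * jointLST μ ξ (-ξ))) L ∧
        ∫ ω, discounted (ladderTime B A) (idlePeriod B A) z s ω ∂Pr
          = 1 - Complex.exp (1 / (2 * Real.pi * Complex.I) * L) := by
  have hm := measurable_planeWalk hB hA
  obtain ⟨hint, hval⟩ := integrable_discounted_and_integral_eq hB hA hindep hlaw
    (y := fun p => p.2 - p.1) (by fun_prop)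
    (fun p q => by simp only [Prod.fst_add, Prod.snd_add]; ring)
    (Eventually.of_forall fun ω n hn => (sub_pos.2 (mem_compl_upperHalf.1 hn)).le)
    (Y := idlePeriod B A) (fun n ω hω => by
      simp only [idlePeriod]
      rw [stoppedValue_of_mem_exitsAt hω, walk_eq_planeWalk, neg_sub]) hs hz
  have hX : ∀ n, Measurable fun ω => (planeWalk B A n ω).2 - (planeWalk B A n ω).1 := fun n =>
    (hm n).snd.sub (hm n).fst
  -- The kernel 1/(s - ξ) selects positive values, so it is applied to X = -S_n; the reflection ξ ↦
  -- -ξ then turns it into 1/(s + ξ).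
  have hPV := hasPVIntegral_of_eq_tsum (Pr := Pr) hs (summable_norm_neg_pow_div hz)
    (W := fun _ _ => 1) (X := fun n ω => (planeWalk B A n ω).2 - (planeWalk B A n ω).1)
    (fun n => measurable_const) hX (fun n => Eventually.of_forall fun ω => by simp)
    (fun n hn => by
      filter_upwards [htie n (ne_zero_of_neg_pow_div_ne_zero hn)] with ω hω h
      exact hω (by linarith))
    (Ψ := fun ξ => Complex.log (1 - z * jointLST μ (-ξ) ξ)) (fun t => by
      rw [log_one_sub_eq_tsum hB hA hindep hlaw hquad (by simp) (by simp) hz]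
      refine tsum_congr fun n => ?_
      congr 1
      refine integral_congr_ae (Eventually.of_forall fun ω => ?_)
      simp only [one_mul]
      push_cast; ring_nf)
  refine ⟨hint, 2 * Real.pi * Complex.I * ∑' n : ℕ, -(z ^ n / n) *
      ∫ ω in planeWalk B A n ⁻¹' upperHalfᶜ,
        Complex.exp (-s * ((planeWalk B A n ω).2 - (planeWalk B A n ω).1 : ℝ)) ∂Pr,
    HasPVIntegral.comp_neg ?_, ?_⟩
  · convert hPV using 2
    · simp [sub_eq_add_neg]
    · refine tsum_congr fun n => ?_
      rw [← integral_indicator (hm n measurableSet_upperHalf.compl)]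
      congr 2
      ext ω
      simp only [Set.indicator, Set.mem_preimage, mem_compl_upperHalf, Set.mem_ofPred_eq, sub_pos,
        one_mul]
  · rw [hval, one_div_two_pi_I_mul]

/-- The transform of the busy period. -/
theorem busyPeriod_transform (hB : ∀ n, Measurable (B n))
    (hA : ∀ n, Measurable (A n)) (hindep : iIndepFun (fun n ω => (B n ω, A n ω)) Pr)
    (hlaw : ∀ n, Pr.map (fun ω => (B n ω, A n ω)) = μ)
    (hquad : ∀ᵐ p ∂(μ : Measure (ℝ × ℝ)), 0 ≤ p.1 ∧ 0 ≤ p.2)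
    (htie : ∀ n : ℕ, n ≠ 0 → ∀ᵐ ω ∂Pr, (planeWalk B A n ω).1 - (planeWalk B A n ω).2 ≠ 0)
    (h0 : (μ : Measure (ℝ × ℝ)) {p | p.1 = 0} = 0)
    {s z : ℂ} (hs : 0 < s.re) (hz : ‖z‖ < 1) :
    Integrable (discounted (ladderTime B A) (busyPeriod B A) z s) Pr ∧
      ∃ L : ℂ,
        HasPVIntegral (fun ξ => 1 / (s - ξ) * (Complex.log (1 - z * jointLST μ ξ 0)
            - Complex.log (1 - z * jointLST μ ξ (s - ξ)))) L ∧
        ∫ ω, discounted (ladderTime B A) (busyPeriod B A) z s ω ∂Pr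
          = 1 - Complex.exp (1 / (2 * Real.pi * Complex.I) * L) := by
  have hm := measurable_planeWalk hB hA
  have hnn := ae_planeWalk_nonneg hB hA hlaw hquad
  have hne := fun (n : ℕ) (hn : n ≠ 0) => ae_planeWalk_fst_ne_zero hB hA hlaw hquad h0 hn
  obtain ⟨hint, hval⟩ := integrable_discounted_and_integral_eq hB hA hindep hlaw
    (y := fun p => p.1) (by fun_prop) (fun p q => rfl)
    (hnn.mono fun ω hω n _ => (hω n).1)
    (Y := busyPeriod B A) (fun n ω hω => by
      simp only [busyPeriod]
      rw [stoppedValue_of_mem_exitsAt hω, planeWalk_fst]) hs hz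
  have hle : ∀ n, ∀ᵐ ω ∂Pr, ‖Complex.exp (-s * (planeWalk B A n ω).2)‖ ≤ 1 := fun n => by
    filter_upwards [hnn] with ω hω
    rw [Complex.norm_exp, Real.exp_le_one_iff]
    have := mul_nonneg hs.le (hω n).2
    simpa using this
  have hsum := summable_norm_neg_pow_div hz
  have hm1 : ∀ n, Measurable fun ω => (planeWalk B A n ω).1 := fun n => (hm n).fst
  have hm2 : ∀ n, Measurable fun ω => (planeWalk B A n ω).2 := fun n => (hm n).snd
  have hPV1 := hasPVIntegral_of_eq_tsum (Pr := Pr) hs hsum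
    (W := fun _ _ => 1) (X := fun n ω => (planeWalk B A n ω).1)
    (fun n => measurable_const) hm1 (fun n => Eventually.of_forall fun ω => by simp)
    (fun n hn => hne n (ne_zero_of_neg_pow_div_ne_zero hn))
    (Ψ := fun ξ => Complex.log (1 - z * jointLST μ ξ 0)) (fun t => by
      rw [log_one_sub_eq_tsum hB hA hindep hlaw hquad (by simp) (by simp) hz]
      refine tsum_congr fun n => ?_
      congr 1
      refine integral_congr_ae (Eventually.of_forall fun ω => ?_)
      simp)
  -- In h(ξ, s - ξ)^n the exponent is -s a_n - ξ S_n: the first part becomes the weight `W`, and the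
  -- kernel evaluates the second at ξ = s, giving e^{-s a_n} e^{-s S_n} = e^{-s b_n} on {S_n > 0}.
  have hPV2 := hasPVIntegral_of_eq_tsum (Pr := Pr) hs hsum
    (W := fun n ω => Complex.exp (-s * (planeWalk B A n ω).2))
    (X := fun n ω => (planeWalk B A n ω).1 - (planeWalk B A n ω).2)
    (fun n => by have := hm2 n; fun_prop) (fun n => (hm1 n).sub (hm2 n)) hle
    (fun n hn => htie n (ne_zero_of_neg_pow_div_ne_zero hn))
    (Ψ := fun ξ => Complex.log (1 - z * jointLST μ ξ (s - ξ))) (fun t => by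
      rw [log_one_sub_eq_tsum hB hA hindep hlaw hquad (by simp) (by simpa using hs.le) hz]
      refine tsum_congr fun n => ?_
      congr 1
      refine integral_congr_ae (Eventually.of_forall fun ω => ?_)
      simp only
      rw [← Complex.exp_add]
      push_cast; ring_nf)
  refine ⟨hint, 2 * Real.pi * Complex.I * ∑' n : ℕ, -(z ^ n / n) *
      ∫ ω in planeWalk B A n ⁻¹' upperHalfᶜ, Complex.exp (-s * (planeWalk B A n ω).1) ∂Pr, ?_, ?_⟩
  · have hfin := hPV1.sub hPV2
    simp_rw [mul_sub (1 / (s - _))]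
    convert hfin using 1
    have hle1 : ∀ n, ∀ᵐ ω ∂Pr, ‖Complex.exp (-s * (planeWalk B A n ω).1)‖ ≤ 1 := fun n => by
      filter_upwards [hnn] with ω hω
      rw [Complex.norm_exp, Real.exp_le_one_iff]
      have := mul_nonneg hs.le (hω n).1
      simpa using this
    have hmE : ∀ n, Measurable fun ω => Complex.exp (-s * (planeWalk B A n ω).1) := fun n => by
      have := hm1 n; fun_prop
    have hI : ∀ n, Integrable (fun ω => Complex.exp (-s * (planeWalk B A n ω).1)) Pr := fun n =>
      Integrable.of_bound (hmE n).aestronglyMeasurable 1 (hle1 n)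
    have hS1 : ∀ n, MeasurableSet {ω | 0 < (planeWalk B A n ω).1} := fun n =>
      measurableSet_lt measurable_const (hm1 n)
    have hS2 : ∀ n, MeasurableSet {ω | 0 < (planeWalk B A n ω).1 - (planeWalk B A n ω).2} :=
      fun n => measurableSet_lt measurable_const ((hm1 n).sub (hm2 n))
    have hJ1 : ∀ n, Integrable ({ω | 0 < (planeWalk B A n ω).1}.indicator
        fun ω => 1 * Complex.exp (-s * (planeWalk B A n ω).1)) Pr := fun n => by
      simp only [one_mul]
      exact (hI n).indicator (hS1 n)
    have hJ2 : ∀ n, Integrable ({ω | 0 < (planeWalk B A n ω).1 - (planeWalk B A n ω).2}.indicator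
        fun ω => Complex.exp (-s * (planeWalk B A n ω).2)
          * Complex.exp (-s * ((planeWalk B A n ω).1 - (planeWalk B A n ω).2 : ℝ))) Pr := by
      intro n
      refine ((hI n).indicator (hS2 n)).congr (Eventually.of_forall fun ω => ?_)
      simp only [Set.indicator]
      split_ifs
      · rw [← Complex.exp_add]; push_cast; ring_nf
      · rfl
    have hb : ∀ {f : Ω → ℂ}, (∀ᵐ ω ∂Pr, ‖f ω‖ ≤ 1) → ‖∫ ω, f ω ∂Pr‖ ≤ 1 := fun hf => by
      simpa only [probReal_univ, mul_one] using norm_integral_le_of_norm_le_const hf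
    have hsum' : ∀ {r : ℕ → ℂ}, (∀ n, ‖r n‖ ≤ 1) → Summable fun n : ℕ => -(z ^ n / n) * r n :=
      fun hr => Summable.of_norm_bounded hsum fun n => by
        rw [norm_mul]; exact mul_le_of_le_one_right (norm_nonneg _) (hr n)
    rw [← mul_sub, ← Summable.tsum_sub]
    · congr 1
      refine tsum_congr fun n => ?_
      rw [← mul_sub]
      rcases eq_or_ne n 0 with rfl | hn
      · simp
      congr 1
      rw [← integral_indicator (hm n measurableSet_upperHalf.compl), ← integral_sub (hJ1 n) (hJ2 n)]
      refine integral_congr_ae ?_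
      filter_upwards [hnn, hne n hn, htie n hn] with ω h1 h2 h3
      have hpos : 0 < (planeWalk B A n ω).1 := lt_of_le_of_ne (h1 n).1 (Ne.symm h2)
      have hexp : Complex.exp (-s * (planeWalk B A n ω).2)
          * Complex.exp (-s * ((planeWalk B A n ω).1 - (planeWalk B A n ω).2 : ℝ))
          = Complex.exp (-s * (planeWalk B A n ω).1) := by
        rw [← Complex.exp_add]; push_cast; ring_nf
      simp only [Set.indicator, Set.mem_preimage, mem_compl_upperHalf, Set.mem_ofPred_eq, hpos,
        if_true, one_mul, hexp]
      -- With b_n > 0 and S_n ≠ 0, the indicators of {b_n > 0} and {S_n > 0} differ exactly by that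
      -- of {S_n < 0}.
      rcases lt_or_gt_of_ne h3 with h | h
      · rw [if_pos (by linarith), if_neg (by linarith), sub_zero]
      · rw [if_neg (by linarith), if_pos (by linarith), sub_self]
    · refine hsum' fun n => hb ?_
      filter_upwards [hle1 n] with ω hω
      simp only [one_mul]
      exact (norm_indicator_le_norm_self _ _).trans hω
    · refine hsum' fun n => hb ?_
      filter_upwards [hle1 n] with ω hω
      refine (norm_indicator_le_norm_self _ _).trans (le_of_eq_of_le ?_ hω)
      rw [← Complex.exp_add]; push_cast; ring_nf
  · rw [hval, one_div_two_pi_I_mul]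

end Transforms

end CorrelatedWalk

theorem mainTheorem2 {Ω : Type*} [MeasurableSpace Ω] (Pr : Measure Ω) [IsProbabilityMeasure Pr]
    (μ : Measure (ℝ × ℝ)) (B A : ℕ → Ω → ℝ)
    (hB : ∀ n, Measurable (B n)) (hA : ∀ n, Measurable (A n))
    -- the pairs `(B_i, A_i)` are i.i.d. with law `μ`, supported on the nonnegative quadrant
    (hindep : iIndepFun (fun n ω => (B n ω, A n ω)) Pr)
    (hlaw : ∀ n, Pr.map (fun ω => (B n ω, A n ω)) = μ)
    (hquad : ∀ᵐ p ∂μ, 0 ≤ p.1 ∧ 0 ≤ p.2)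
    -- there are no ties
    (htie : ∀ n : ℕ, 1 ≤ n → Pr {ω | CorrelatedWalk.walk B A n ω = 0} = 0)
    (s z : ℂ) (hs : 0 < s.re) (hz : ‖z‖ < 1) :
    -- busy period (when the service times are almost surely positive)
    (μ {p | p.1 = 0} = 0 →
      Integrable (CorrelatedWalk.discounted (CorrelatedWalk.ladderTime B A)
        (CorrelatedWalk.busyPeriod B A) z s) Pr ∧
      ∃ L : ℂ,
        CorrelatedWalk.HasPVIntegral (fun ξ => 1 / (s - ξ) *
          (Complex.log (1 - z * CorrelatedWalk.jointLST μ ξ 0)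
            - Complex.log (1 - z * CorrelatedWalk.jointLST μ ξ (s - ξ)))) L ∧
        ∫ ω, CorrelatedWalk.discounted (CorrelatedWalk.ladderTime B A)
            (CorrelatedWalk.busyPeriod B A) z s ω ∂Pr
          = 1 - Complex.exp (1 / (2 * Real.pi * Complex.I) * L)) ∧
    -- idle period
    (Integrable (CorrelatedWalk.discounted (CorrelatedWalk.ladderTime B A)
        (CorrelatedWalk.idlePeriod B A) z s) Pr ∧
      ∃ L : ℂ,
        CorrelatedWalk.HasPVIntegral (fun ξ => 1 / (s + ξ) *
          Complex.log (1 - z * CorrelatedWalk.jointLST μ ξ (-ξ))) L ∧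
        ∫ ω, CorrelatedWalk.discounted (CorrelatedWalk.ladderTime B A)
            (CorrelatedWalk.idlePeriod B A) z s ω ∂Pr
          = 1 - Complex.exp (1 / (2 * Real.pi * Complex.I) * L)) := by
  have hμ : IsFiniteMeasure μ := by
    rw [← hlaw 0]; infer_instance
  have htie' : ∀ n : ℕ, n ≠ 0 → ∀ᵐ ω ∂Pr, (CorrelatedWalk.planeWalk B A n ω).1
      - (CorrelatedWalk.planeWalk B A n ω).2 ≠ 0 := fun n hn => by
    rw [ae_iff]
    simpa only [not_not, ← CorrelatedWalk.walk_eq_planeWalk] using htie n (Nat.pos_of_ne_zero hn)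
  exact ⟨fun h0 => CorrelatedWalk.busyPeriod_transform (μ := ⟨μ, hμ⟩) hB hA hindep hlaw hquad htie'
      h0 hs hz,
    CorrelatedWalk.idlePeriod_transform (μ := ⟨μ, hμ⟩) hB hA hindep hlaw hquad htie' hs hz⟩
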